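/- **Conventions.** All registers consist of qubits; QPT means a polynomial-time uniform family of quantum circuits (over the gates $H$, $T$, CNOT, with ancillas in $|0\rangle$ and discarding of qubits), where on input $1^n$ a Turing machine outputs the description of the $n$-th circuit (with oracle queries, for oracle algorithms) in time polynomial in $n$. A function is negligible if it decays faster than every inverse polynomial. A *symmetric-key quantum encryption scheme* $\Pi=(\mathsf{KeyGen},\mathsf{Enc},\mathsf{Dec})$ consists of QPT algorithms such that $\mathsf{KeyGen}(1^n)$ outputs a uniform key $k$ from a finite key space, $\mathsf{Enc}_k$ is a channel from a plaintext register $M$ to a ciphertext register $C$, and $\mathsf{Dec}_k$ is a channel from $C$ to $\mathcal H_M\oplus\mathbb C|\bot\rangle$ (followed by the measurement of whether the result is $\bot$), with $\|\mathsf{Dec}_k\circ\mathsf{Enc}_k-\mathrm{id}_M\oplus 0_\bot\|_\diamond\le\mathrm{negl}(n)$ for all keys $k$. Fix for $\Pi$ a characterization of its encryption: for every key $k$, a unitary $V_k$ from $M\otimes T$ to $C$ ($T$ a register of $t$ qubits), a probability distribution $p_k$ on $\{0,1\}^t$, and an orthonormal basis $(|\psi^{(k,r)}\rangle)_{r\in\{0,1\}^t}$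 of $T$, such that $\mathsf{Enc}_k=\sum_r p_k(r)\,\mathsf{Enc}_{k;r}$ with $\mathsf{Enc}_{k;r}(X)=V_k(X\otimes|\psi^{(k,r)}\rangle\langle\psi^{(k,r)}|)V_k^\dagger$. All notions below refer to it. Write $\Pi_{k,r}=|\psi^{(k,r)}\rangle\langle\psi^{(k,r)}|_T$, let $|\phi^+\rangle$ be the maximally entangled state of two copies of $M$, and $\Pi^+=|\phi^+\rangle\langle\phi^+|$. * *Efficiency condition (Condition 1).* There are QPT algorithms for sampling from $p_k$, preparing $|\psi^{(k,r)}\rangle$ and applying $V_k$ (up to negligible error), for all but a negligible fraction of $k$ and $r$ ($k$ a uniform key, $r\leftarrow p_k$). * *QAE.* For every QPT adversary $\mathcal A$ with two oracles, the probabilities that $\mathcal A$ outputs $1$ in the following two experiments, both with $k\leftarrow\mathsf{KeyGen}(1^n)$, differ by at most a negligible amount. *Real:* the oracles are $\mathsf{Enc}_k$ and $\mathsf{Dec}_k$. *Ideal:* on input $M$, the encryption oracle prepares $|\phi^+\rangle_{M'M''}$, samples $r\leftarrow p_k$, stores $(r,M'',M)$ and returns $\mathsf{Enc}_{k;r}$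 applied to $M'$. On input $C$, the decryption oracle applies $V_k^\dagger$ to obtain $M'T$; for each stored $(r,M'',M)$, in the order in which they were stored, it measures $\{\Pi_{k,r},1-\Pi_{k,r}\}$ on $T$ and, if the first outcome occurs, measures $\{\Pi^+,1-\Pi^+\}$ on $M'M''$; if the first outcome occurs again, it returns the stored register $M$ (and the entry is removed). If no entry succeeds it returns $|\bot\rangle\langle\bot|$. * *cQCA.* For every attack map $\Lambda_{CB\to C\tilde B}$ given by a QPT algorithm, the effective attack $\mathbb E_k[\mathsf{Dec}_k\circ\Lambda\circ\mathsf{Enc}_k]$ is computationally indistinguishable from the simulator $\Lambda^{\mathrm{sim}}=\mathrm{id}_M\otimes\Lambda^{\mathrm{acc}}+|\bot\rangle\langle\bot|_M\otimes\Lambda^{\mathrm{rej}}$ (the second summand discards the input $M$), where, with $|\Phi_{k,r}\rangle=|\phi^+\rangle_{MM'}\otimes|\psi^{(k,r)}\rangle_T$, $$\Lambda^{\mathrm{acc}}(Z)=\mathbb E_{k,r}\big[\langle\Phi_{k,r}|V_k^\dagger\Lambda(\mathsf{Enc}_{k;r}(\phi^+_{MM'}\otimes Z))V_k|\Phi_{k,r}\rangle\big],$$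 $$\Lambda^{\mathrm{rej}}(Z)=\mathbb E_{k,r}\big[\mathrm{Tr}_{MM'T}\big((1-|\Phi_{k,r}\rangle\langle\Phi_{k,r}|)V_k^\dagger\Lambda(\mathsf{Enc}_{k;r}(\phi^+_{MM'}\otimes Z))V_k\big)\big].$$ Here, indistinguishable means that for all QPT algorithms $\mathcal A_1$ (without input, preparing $MB$) and $\mathcal A_3$ (outputting one bit), the probabilities that $\mathcal A_3$ outputs $1$ on the results of the two maps, applied to the state prepared by $\mathcal A_1$, differ by at most a negligible amount. **Theorem.** Let $\Pi$ be a symmetric-key quantum encryption scheme that is QAE secure and satisfies the efficiency condition. Then $\Pi$ is cQCA. Moreover, for every $n$ and every linear attack map $\Lambda_{CB\to C\tilde B}$, the map from $MB$ to $(M\oplus\bot)\tilde B$ that results from an encryption query with $M$ to the ideal QAE oracle, applying $\Lambda$, and a decryption query with the resulting register $C$ to the ideal QAE oracle (discarding the oracles' memory at the end) equals the simulator $\Lambda^{\mathrm{sim}}$. -/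

import Mathlib

set_option synthInstance.maxSize 1000

noncomputable section

namespace QuantumAE

open scoped Kronecker BigOperators

/-! ### Registers, operators and maps on operators -/

/-- Computational basis of a register of `w` qubits. -/
abbrev Bits (w : ℕ) : Type := Fin w → Bool

/-- Operators on the finite-dimensional Hilbert space with orthonormal basis `α`. -/
abbrev Op (α : Type) : Type := Matrix α α ℂ

/-- Maps from operators on `α` to operators on `β`. -/
abbrev SuperOp (α β : Type) : Type := Op α → Op β

/-- `Φ ⊗ id_E`: the map `Φ` applied to the first tensor factor. -/
def ampl {α β : Type} {E : Type} (Φ : SuperOp α β) : SuperOp (α × E) (β × E) :=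
  fun ρ => Matrix.of fun p q => Φ (Matrix.of fun a a' => ρ (a, p.2) (a', q.2)) p.1 q.1

/-- Partial trace over the second tensor factor. -/
def trRight {α E : Type} [Fintype E] : SuperOp (α × E) α :=
  fun ρ => Matrix.of fun a a' => ∑ e, ρ (a, e) (a', e)

/-- Partial trace over the first tensor factor. -/
def trLeft {α E : Type} [Fintype α] : SuperOp (α × E) E :=
  fun ρ => Matrix.of fun e e' => ∑ a, ρ (a, e) (a, e')

/-- A pair of registers of `p` and `s` qubits seen as one register of `p + s` qubits. -/
def join (p s : ℕ) : SuperOp (Bits p × Bits s) (Bits (p + s)) :=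
  fun ρ => ρ.submatrix (Fin.appendEquiv p s).symm (Fin.appendEquiv p s).symm

/-- A register of `p + s` qubits seen as a pair of registers. -/
def split (p s : ℕ) : SuperOp (Bits (p + s)) (Bits p × Bits s) :=
  fun ρ => ρ.submatrix (Fin.appendEquiv p s) (Fin.appendEquiv p s)

/-- The trace norm: the sum of the singular values. -/
def traceNorm {α : Type} [Fintype α] [DecidableEq α] (X : Op α) : ℝ :=
  ∑ i, Real.sqrt ((Matrix.isHermitian_conjTranspose_mul_self X).eigenvalues i)

/-- The diamond norm of a (linear) map: the supremum of `‖(Δ ⊗ id)(X)‖₁` over `‖X‖₁ ≤ 1`, with a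
reference system of the dimension of the input. -/
def diamondNorm {α β : Type} [Fintype α] [DecidableEq α] [Fintype β] [DecidableEq β]
    (Δ : SuperOp α β) : ℝ :=
  ⨆ X : {X : Op (α × α) // traceNorm X ≤ 1}, traceNorm (ampl (E := α) Δ X.1)

/-- Negligible functions of the security parameter: smaller than any inverse polynomial. -/
def Negligible (ε : ℕ → ℝ) : Prop :=
  Asymptotics.SuperpolynomialDecay Filter.atTop (fun n : ℕ => (n : ℝ)) ε

/-! ### Quantum circuits -/

/-- Elementary gates on `w` wires: Hadamard, `T` (the `π/8` gate) and controlled-NOT. -/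
inductive Gate (w : ℕ) : Type
  | had (i : Fin w)
  | tee (i : Fin w)
  | cnot (i j : Fin w) (h : i ≠ j)

/-- The unitary matrix of a gate. -/
def Gate.mat {w : ℕ} : Gate w → Op (Bits w)
  | .had i => Matrix.of fun x y =>
      if ∀ j, j ≠ i → x j = y j then (if x i && y i then -1 else 1) / (Real.sqrt 2 : ℂ) else 0
  | .tee i => Matrix.diagonal fun x =>
      if x i then Complex.exp (Complex.I * (Real.pi / 4 : ℝ)) else 1
  | .cnot i j _ => Matrix.of fun x y =>
      if x = Function.update y j (xor (y i) (y j)) then 1 else 0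

/-- A quantum circuit from `i` qubits to `o` qubits. It acts on `wires` wires; the first `i` of
them carry the input and all others start in `|0⟩`; at the end the first `o` wires are the output
and all others are discarded. (Measurements and randomness are obtained from discarded wires.) -/
structure Circ (i o : ℕ) : Type where
  wires : ℕ
  in_le : i ≤ wires
  out_le : o ≤ wires
  gates : List (Gate wires)

namespace Circ

variable {i o : ℕ}

/-- The unitary of the gate list; the head of the list is applied first. -/
def unitary (C : Circ i o) : Op (Bits C.wires) :=
  C.gates.foldl (fun U g => g.mat * U) 1

/-- Basis state of all wires: input `x`, followed by zeros. -/
def inIdx (C : Circ i o) (x : Bits i) : Bits C.wires :=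
  fun j => if h : j.val < i then x ⟨j.val, h⟩ else false

/-- Basis state of all wires: output `y`, and `z` on the discarded wires. -/
def outIdx (C : Circ i o) (y : Bits o) (z : {j : Fin C.wires // ¬ j.val < o} → Bool) :
    Bits C.wires :=
  fun j => if h : j.val < o then y ⟨j.val, h⟩ else z ⟨j, h⟩

/-- Kraus operator of the circuit for the value `z` of the discarded wires. -/
def kraus (C : Circ i o) (z : {j : Fin C.wires // ¬ j.val < o} → Bool) :
    Matrix (Bits o) (Bits i) ℂ :=
  Matrix.of fun y x => C.unitary (C.outIdx y z) (C.inIdx x)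

/-- The quantum channel implemented by the circuit. -/
def run (C : Circ i o) : SuperOp (Bits i) (Bits o) :=
  fun ρ => ∑ z, C.kraus z * ρ * (C.kraus z).conjTranspose

/-- The channel of a circuit whose input and output are pairs of registers. -/
def run₂ {p s p' s' : ℕ} (C : Circ (p + s) (p' + s')) :
    SuperOp (Bits p × Bits s) (Bits p' × Bits s') :=
  fun ρ => split p' s' (C.run (join p s ρ))

/-- The channel obtained by fixing the classical value `k` of the first input register. -/
def keyed {κ i o : ℕ} (C : Circ (κ + i) o) (k : Bits κ) : SuperOp (Bits i) (Bits o) :=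
  fun ρ => C.run (join κ i (Matrix.single k k 1 ⊗ₖ ρ))

/-- The output state of a circuit without input. -/
def prepare (C : Circ 0 o) : Op (Bits o) := C.run 1

/-- The probability that a circuit with one output qubit outputs `1`. -/
def probOne {p s : ℕ} (C : Circ (p + s) 1) (ρ : Op (Bits p × Bits s)) : ℝ :=
  (C.run (join p s ρ) (fun _ => true) (fun _ => true)).re

end Circ

/-! ### Descriptions of circuits and uniformity -/

/-- The alphabet of descriptions. -/
inductive Tok : Type
  | one | sep | had | tee | cnot | enc | dec | fin

/-- Unary description of a number. -/
def encNat (a : ℕ) : List Tok := List.replicate a Tok.one ++ [Tok.sep]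

def Gate.encode {w : ℕ} : Gate w → List Tok
  | .had i => Tok.had :: encNat i
  | .tee i => Tok.tee :: encNat i
  | .cnot i j _ => Tok.cnot :: (encNat i ++ encNat j)

/-- Description of a circuit: its numbers of input qubits, output qubits and wires, and its
gates. -/
def Circ.encode {i o : ℕ} (C : Circ i o) : List Tok :=
  encNat i ++ encNat o ++ encNat C.wires ++ C.gates.flatMap Gate.encode ++ [Tok.fin]

/-- `n ↦ f n` is computed, on input `1ⁿ`, by a Turing machine in time polynomial in `n`. -/
def PolyTime (f : ℕ → List Tok) : Prop :=
  Nonempty (Turing.TM2ComputableInPolyTime Computability.unaryEncodeNat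
    (fun l : List Tok => l) f)

/-- A polynomial-time uniform family of quantum circuits (a QPT algorithm). -/
def QPT {i o : ℕ → ℕ} (C : ∀ n, Circ (i n) (o n)) : Prop := PolyTime fun n => (C n).encode

/-! ### The space `H_M ⊕ ℂ|⊥⟩`, with `none` as the basis vector `|⊥⟩` -/

/-- Encoding of the basis of `H_M ⊕ ℂ|⊥⟩` into `m + 1` qubits: the first qubit is the flag for
rejection. -/
def flagged {m : ℕ} : Option (Bits m) → Bits (m + 1)
  | some x => Fin.cons (α := fun _ => Bool) false x
  | none => Fin.cons (α := fun _ => Bool) true (fun _ => false)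

/-- The isometric embedding of `H_M ⊕ ℂ|⊥⟩` into `m + 1` qubits. -/
def toQubits {m : ℕ} : SuperOp (Option (Bits m)) (Bits (m + 1)) :=
  fun ρ =>
    let J : Matrix (Bits (m + 1)) (Option (Bits m)) ℂ :=
      Matrix.of fun y a => if y = flagged a then 1 else 0
    J * ρ * J.conjTranspose

/-- Measure the flag qubit; on acceptance keep the other qubits, on rejection replace them by
`|⊥⟩⟨⊥|`. -/
def measureFlag {m : ℕ} : SuperOp (Bits (m + 1)) (Option (Bits m)) :=
  fun ρ => Matrix.of fun a a' =>
    match a, a' with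
    | some x, some x' =>
        ρ (Fin.cons (α := fun _ => Bool) false x) (Fin.cons (α := fun _ => Bool) false x')
    | none, none =>
        ∑ y : Bits m, ρ (Fin.cons (α := fun _ => Bool) true y) (Fin.cons (α := fun _ => Bool) true y)
    | _, _ => 0

/-- The map `id_M ⊕ 0_⊥`. -/
def embedPlain {m : ℕ} : SuperOp (Bits m) (Option (Bits m)) :=
  fun X => Matrix.of fun a a' =>
    match a, a' with
    | some x, some x' => X x x'
    | _, _ => 0

/-! ### Symmetric-key quantum encryption schemes -/

/-- A symmetric-key quantum encryption scheme with keys of `κ n` bits, plaintexts of `m n` qubits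
and ciphertexts of `c n` qubits. The key generation, encryption and decryption algorithms are QPT,
keys are uniform on the key space, and decryption inverts encryption up to a negligible error. -/
structure SKQES : Type where
  κ : ℕ → ℕ
  m : ℕ → ℕ
  c : ℕ → ℕ
  keyGen : ∀ n, Circ 0 (κ n)
  encC : ∀ n, Circ (κ n + m n) (c n)
  decC : ∀ n, Circ (κ n + c n) (m n + 1)
  keyGen_qpt : QPT keyGen
  encC_qpt : QPT encC
  decC_qpt : QPT decC
  keys : ∀ n, Finset (Bits (κ n))
  keys_nonempty : ∀ n, (keys n).Nonempty
  keyGen_uniform : ∀ n k,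
    (keyGen n).prepare k k = if k ∈ keys n then ((keys n).card : ℂ)⁻¹ else 0
  correct : ∃ ε : ℕ → ℝ, Negligible ε ∧ ∀ n, ∀ k ∈ keys n,
    diamondNorm (fun X : Op (Bits (m n)) =>
      measureFlag ((decC n).keyed k ((encC n).keyed k X)) - embedPlain X) ≤ ε n

namespace SKQES

variable (𝒮 : SKQES)

/-- `Enc_k`. -/
def Enc (n : ℕ) (k : Bits (𝒮.κ n)) : SuperOp (Bits (𝒮.m n)) (Bits (𝒮.c n)) :=
  (𝒮.encC n).keyed k

/-- `Dec_k`, including the measurement of whether decryption rejected. -/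
def Dec (n : ℕ) (k : Bits (𝒮.κ n)) : SuperOp (Bits (𝒮.c n)) (Option (Bits (𝒮.m n))) :=
  fun X => measureFlag ((𝒮.decC n).keyed k X)

/-- Expectation over a key drawn by key generation. -/
def keyAvg {A : Type} [AddCommMonoid A] [Module ℝ A] (n : ℕ) (f : Bits (𝒮.κ n) → A) : A :=
  ((𝒮.keys n).card : ℝ)⁻¹ • ∑ k ∈ 𝒮.keys n, f k

end SKQES

/-! ### Encryption as a random pure state, attached to the plaintext, and a unitary -/

/-- For a fixed key: a unitary `V` from plaintext and tag register to the ciphertext register, a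
probability distribution on strings `r`, and an orthonormal basis of states `ψ r` of the tag
register. -/
structure EncForm (m t c : ℕ) : Type where
  V : Matrix (Bits c) (Bits m × Bits t) ℂ
  V_left : V.conjTranspose * V = 1
  V_right : V * V.conjTranspose = 1
  prob : Bits t → ℝ
  prob_nonneg : ∀ r, 0 ≤ prob r
  prob_sum : ∑ r, prob r = 1
  ψ : Bits t → Bits t → ℂ
  ψ_orthonormal : ∀ r r', ∑ τ, star (ψ r τ) * ψ r' τ = if r = r' then 1 else 0

namespace EncForm

variable {m t c : ℕ} (F : EncForm m t c)

/-- The projector `|ψ r⟩⟨ψ r|` on the tag register. -/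
def proj (r : Bits t) : Op (Bits t) := Matrix.vecMulVec (F.ψ r) (star (F.ψ r))

/-- Encryption with randomness `r`: `X ↦ V (X ⊗ |ψ r⟩⟨ψ r|) V†`. -/
def encR (r : Bits t) : SuperOp (Bits m) (Bits c) :=
  fun X => F.V * (X ⊗ₖ F.proj r) * F.V.conjTranspose

/-- `Y ↦ V† Y V`. -/
def unV : SuperOp (Bits c) (Bits m × Bits t) :=
  fun Y => F.V.conjTranspose * Y * F.V

end EncForm

/-- A characterization of the encryption map of a scheme: `Enc_k` draws `r` from the distribution
of `form n k` and applies `EncForm.encR`. -/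
structure Characterization (𝒮 : SKQES) : Type where
  t : ℕ → ℕ
  form : ∀ n, Bits (𝒮.κ n) → EncForm (𝒮.m n) (t n) (𝒮.c n)
  enc_eq : ∀ n, ∀ k ∈ 𝒮.keys n, ∀ X,
    𝒮.Enc n k X = ∑ r, (form n k).prob r • (form n k).encR r X

/-- Sampling from `p_k`, preparing `|ψ^{(k,r)}⟩` and applying `V_k` are all achieved by the given
circuits up to error `ε`, for the key `k` and the string `r`. -/
def ImplementedAt {κ m t c : ℕ} (F : EncForm m t c) (samp : Circ κ t)
    (prep : Circ (κ + t) t) (appV : Circ (κ + (m + t)) c) (k : Bits κ) (r : Bits t) (ε : ℝ) :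
    Prop :=
  ∑ r', |(samp.run (Matrix.single k k 1) r' r').re - F.prob r'| ≤ ε ∧
  traceNorm (prep.keyed k (Matrix.single r r 1) - F.proj r) ≤ ε ∧
  diamondNorm (fun X : Op (Bits m × Bits t) =>
    appV.keyed k (join m t X) - F.V * X * F.V.conjTranspose) ≤ ε

open scoped Classical in
/-- The efficiency condition: sampling from `p_k`, preparing `|ψ^{(k,r)}⟩` and applying `V_k` are
done by QPT algorithms up to negligible error, for all but a negligible fraction of the keys `k`
and strings `r` (with `k` uniform and `r` drawn from `p_k`). -/
def EfficientCondition (𝒮 : SKQES) (D : Characterization 𝒮) : Prop :=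
  ∃ (samp : ∀ n, Circ (𝒮.κ n) (D.t n)) (prep : ∀ n, Circ (𝒮.κ n + D.t n) (D.t n))
    (appV : ∀ n, Circ (𝒮.κ n + (𝒮.m n + D.t n)) (𝒮.c n)) (ε δ : ℕ → ℝ),
    QPT samp ∧ QPT prep ∧ QPT appV ∧ Negligible ε ∧ Negligible δ ∧
    ∀ n, 𝒮.keyAvg n (fun k => ∑ r, if ImplementedAt (D.form n k) (samp n) (prep n) (appV n) k r (ε n)
      then 0 else (D.form n k).prob r) ≤ δ n

/-! ### Adversaries with encryption and decryption oracles -/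

/-- An adversary with oracles for encryption (`m` to `c` qubits) and decryption (`c` qubits to
`m + 1` qubits, the first being the flag for `⊥`), currently holding a register of `p` qubits (the
last oracle answer) and a side register of `s` qubits. It applies a circuit, and then outputs a
bit (`1` means "real"), or queries an oracle with the first register of the result. -/
inductive Adv (m c : ℕ) : ℕ → ℕ → Type
  | done {p s : ℕ} (C : Circ (p + s) 1) : Adv m c p s
  | enc {p s : ℕ} (s' : ℕ) (C : Circ (p + s) (m + s')) (next : Adv m c c s') : Adv m c p s
  | dec {p s : ℕ} (s' : ℕ) (C : Circ (p + s) (c + s')) (next : Adv m c (m + 1) s') : Adv m c p s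

namespace Adv

variable {m c : ℕ}

/-- Description of an adversary. -/
def encode : {p s : ℕ} → Adv m c p s → List Tok
  | _, _, .done C => Tok.fin :: C.encode
  | _, _, .enc _ C next => Tok.enc :: (C.encode ++ next.encode)
  | _, _, .dec _ C next => Tok.dec :: (C.encode ++ next.encode)

/-- Probability of output `1` when the oracles are the channels `E` and `D`. -/
def real (E : SuperOp (Bits m) (Bits c)) (D : SuperOp (Bits c) (Option (Bits m))) :
    {p s : ℕ} → Adv m c p s → Op (Bits p × Bits s) → ℝ
  | _, _, .done C, ρ => C.probOne ρ
  | _, _, .enc _ C next, ρ => next.real E D (ampl E (C.run₂ ρ))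
  | _, _, .dec _ C next, ρ => next.real E D (ampl (fun X => toQubits (D X)) (C.run₂ ρ))

end Adv

/-! ### The ideal oracles -/

/-- Basis of the challenger's quantum memory after `l` encryption queries. Slot `j` holds the pair
`(M'', M)` of the `j`-th query. -/
abbrev Mem (m l : ℕ) : Type := Fin l → Bits m × Bits m

/-- The density operator of the maximally entangled state on two registers of `m` qubits. -/
def phiPlus (m : ℕ) : Op (Bits m × Bits m) :=
  Matrix.of fun u v => if u.1 = u.2 ∧ v.1 = v.2 then ((2 : ℂ) ^ m)⁻¹ else 0

namespace EncForm

variable {m t c : ℕ} (F : EncForm m t c)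

/-- Ideal encryption with randomness `r`: move the query register `M` to the new memory slot,
prepare a maximally entangled state on `M' M''`, keep `M''` in the new slot, and encrypt `M'`. -/
def idealEnc {s l : ℕ} (r : Bits t) :
    SuperOp ((Bits m × Bits s) × Mem m l) ((Bits c × Bits s) × Mem m (l + 1)) :=
  fun ρ => ampl (ampl (F.encR r)) (Matrix.of fun u v =>
    phiPlus m (u.1.1, (u.2 (Fin.last l)).1) (v.1.1, (v.2 (Fin.last l)).1) *
      ρ (((u.2 (Fin.last l)).2, u.1.2), fun j => u.2 j.castSucc)
        (((v.2 (Fin.last l)).2, v.1.2), fun j => v.2 j.castSucc))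

/-- The projector `Π_{k,r}` on the tag register. -/
def projTag {s l : ℕ} (r : Bits t) : Op (((Bits m × Bits t) × Bits s) × Mem m l) :=
  (((1 : Op (Bits m)) ⊗ₖ F.proj r) ⊗ₖ (1 : Op (Bits s))) ⊗ₖ (1 : Op (Mem m l))

end EncForm

/-- The projector onto the maximally entangled state of `M'` and the `M''` in slot `j`. -/
def projPlus {m t s l : ℕ} (j : Fin l) : Op (((Bits m × Bits t) × Bits s) × Mem m l) :=
  Matrix.of fun u v =>
    if u.1.1.2 = v.1.1.2 ∧ u.1.2 = v.1.2 ∧ (u.2 j).2 = (v.2 j).2 ∧ (∀ i, i ≠ j → u.2 i = v.2 i)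
    then phiPlus m (u.1.1.1, (u.2 j).1) (v.1.1.1, (v.2 j).1) else 0

/-- Discard `M' T` and answer with the register `M` of slot `j` (which is left in `|0⟩`). -/
def handOver {m t s l : ℕ} (j : Fin l) :
    SuperOp (((Bits m × Bits t) × Bits s) × Mem m l) ((Option (Bits m) × Bits s) × Mem m l) :=
  fun σ => Matrix.of fun u v =>
    match u.1.1, v.1.1 with
    | some x, some y =>
        if (u.2 j).2 = (fun _ => false) ∧ (v.2 j).2 = (fun _ => false) then
          ∑ w : Bits m × Bits t,
            σ ((w, u.1.2), Function.update u.2 j ((u.2 j).1, x))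
              ((w, v.1.2), Function.update v.2 j ((v.2 j).1, y))
        else 0
    | _, _ => 0

/-- Discard `M' T` and answer with `|⊥⟩⟨⊥|`. -/
def rejectAns {m t s l : ℕ} :
    SuperOp (((Bits m × Bits t) × Bits s) × Mem m l) ((Option (Bits m) × Bits s) × Mem m l) :=
  fun σ => Matrix.of fun u v =>
    match u.1.1, v.1.1 with
    | none, none => ∑ w : Bits m × Bits t, σ ((w, u.1.2), u.2) ((w, v.1.2), v.2)
    | _, _ => 0

namespace EncForm

variable {m t c : ℕ} (F : EncForm m t c)

/-- The loop of the ideal decryption oracle. Entries `(j, r)` say that slot `j` was used with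
randomness `r`; those in `pre` have been tested without success, those in `todo` have not been
tested yet. For each entry, measure `Π_{k,r}` on `T` and, on success, measure `M' M''`; if both
tests succeed, answer with the stored `M` and remove the entry. The result is the list of the
possible outcomes, each with the remaining entries and the (subnormalized) state. -/
def decLoop {s l : ℕ} :
    (pre todo : List (Fin l × Bits t)) → Op (((Bits m × Bits t) × Bits s) × Mem m l) →
      List (List (Fin l × Bits t) × Op ((Option (Bits m) × Bits s) × Mem m l))
  | pre, [], σ => [(pre, rejectAns σ)]
  | pre, (j, r) :: rest, σ =>
      let P := F.projTag (s := s) (l := l) r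
      let Q := projPlus (m := m) (t := t) (s := s) j
      (pre ++ rest, handOver j (Q * (P * σ * P) * Q)) ::
        decLoop (pre ++ [(j, r)]) rest
          ((1 - P) * σ * (1 - P) + (1 - Q) * (P * σ * P) * (1 - Q))

/-- Ideal decryption: undo `V`, then run the loop over all stored entries. -/
def idealDec {s l : ℕ} (entries : List (Fin l × Bits t))
    (ρ : Op ((Bits c × Bits s) × Mem m l)) :
    List (List (Fin l × Bits t) × Op ((Option (Bits m) × Bits s) × Mem m l)) :=
  F.decLoop [] entries (ampl (ampl F.unV) ρ)

end EncForm

/-- Probability of output `1` with the ideal oracles, from a state of the adversary's registers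
and the challenger's memory. -/
def Adv.ideal {m t c : ℕ} (F : EncForm m t c) :
    {p s : ℕ} → Adv m c p s → {l : ℕ} → List (Fin l × Bits t) →
      Op ((Bits p × Bits s) × Mem m l) → ℝ
  | _, _, .done C, _, _, ρ => C.probOne (trRight ρ)
  | _, _, .enc _ C next, l, entries, ρ =>
      ∑ r, F.prob r * next.ideal F
        (entries.map (fun e => (e.1.castSucc, e.2)) ++ [(Fin.last l, r)])
        (F.idealEnc r (ampl C.run₂ ρ))
  | _, _, .dec _ C next, _, entries, ρ =>
      ((F.idealDec entries (ampl C.run₂ ρ)).map fun b =>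
        next.ideal F b.1 (ampl (ampl toQubits) b.2)).sum

/-! ### Authenticated encryption -/

namespace SKQES

variable (𝒮 : SKQES)

/-- Probability that the real experiment outputs "real". -/
def qaeReal (n : ℕ) (A : Adv (𝒮.m n) (𝒮.c n) 0 0) : ℝ :=
  𝒮.keyAvg n fun k => A.real (𝒮.Enc n k) (𝒮.Dec n k) 1

/-- Probability that the ideal experiment outputs "real". -/
def qaeIdeal (D : Characterization 𝒮) (n : ℕ) (A : Adv (𝒮.m n) (𝒮.c n) 0 0) : ℝ :=
  𝒮.keyAvg n fun k => A.ideal (D.form n k) (l := 0) [] 1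

/-- Security as an authenticated quantum encryption scheme (QAE). -/
def IsQAE (D : Characterization 𝒮) : Prop :=
  ∀ A : ∀ n, Adv (𝒮.m n) (𝒮.c n) 0 0, PolyTime (fun n => (A n).encode) →
    Negligible fun n => |𝒮.qaeReal n (A n) - 𝒮.qaeIdeal D n (A n)|

end SKQES

/-! ### Computational ciphertext authentication -/

namespace EncForm

variable {m t c b b' : ℕ} (F : EncForm m t c)

/-- The vector `|Φ_r⟩ = |φ⁺⟩_{MM'} ⊗ |ψ r⟩_T`, on the registers `(M T) M'`. -/
def Phi (r : Bits t) : (Bits m × Bits t) × Bits m → ℂ :=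
  fun u => if u.1.1 = u.2 then (Real.sqrt (2 ^ m) : ℂ)⁻¹ * F.ψ r u.1.2 else 0

/-- The operator `V† Λ(Enc_r(φ⁺_{MM'} ⊗ Z_B)) V`, on the registers `((M T) M') B̃`. -/
def attacked (Λ : SuperOp (Bits c × Bits b) (Bits c × Bits b')) (r : Bits t) (Z : Op (Bits b)) :
    Op (((Bits m × Bits t) × Bits m) × Bits b') :=
  let σ₀ : Op (Bits m × (Bits b × Bits m)) :=
    Matrix.of fun u v => phiPlus m (u.1, u.2.2) (v.1, v.2.2) * Z u.2.1 v.2.1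
  let σ₁ : Op (Bits c × (Bits b × Bits m)) := ampl (F.encR r) σ₀
  let σ₂ : Op ((Bits c × Bits b') × Bits m) :=
    ampl Λ (σ₁.submatrix (fun u => (u.1.1, (u.1.2, u.2))) (fun u => (u.1.1, (u.1.2, u.2))))
  let σ₃ : Op ((Bits m × Bits t) × (Bits b' × Bits m)) :=
    ampl F.unV (σ₂.submatrix (fun u => ((u.1, u.2.1), u.2.2)) (fun u => ((u.1, u.2.1), u.2.2)))
  σ₃.submatrix (fun u => (u.1.1, (u.2, u.1.2))) (fun u => (u.1.1, (u.2, u.1.2)))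

/-- `Λ^acc` for fixed key and randomness: `⟨Φ_r| V† Λ(Enc_r(φ⁺ ⊗ Z)) V |Φ_r⟩`. -/
def simAcc (Λ : SuperOp (Bits c × Bits b) (Bits c × Bits b')) (r : Bits t) :
    SuperOp (Bits b) (Bits b') :=
  fun Z => Matrix.of fun s s' =>
    ∑ u, ∑ v, star (F.Phi r u) * F.attacked Λ r Z (u, s) (v, s') * F.Phi r v

/-- `Λ^reject` for fixed key and randomness: the partial trace over `M T M'` of
`(1 - |Φ_r⟩⟨Φ_r|) V† Λ(Enc_r(φ⁺ ⊗ Z)) V`. -/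
def simRej (Λ : SuperOp (Bits c × Bits b) (Bits c × Bits b')) (r : Bits t) :
    SuperOp (Bits b) (Bits b') :=
  fun Z => trLeft (((1 - Matrix.vecMulVec (F.Phi r) (star (F.Phi r))) ⊗ₖ (1 : Op (Bits b'))) *
    F.attacked Λ r Z)

end EncForm

/-- The map `id_M ⊗ S + |⊥⟩⟨⊥| ⊗ R` from `M B` to `(M ⊕ ⊥) B̃`, where the second summand discards
the input `M`. -/
def acceptOrReject {m b b' : ℕ} (S R : SuperOp (Bits b) (Bits b')) :
    SuperOp (Bits m × Bits b) (Option (Bits m) × Bits b') :=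
  fun ρ => Matrix.of fun u v =>
    match u.1, v.1 with
    | some x, some y => S (Matrix.of fun z z' => ρ (x, z) (y, z')) u.2 v.2
    | none, none => R (trLeft ρ) u.2 v.2
    | _, _ => 0

namespace SKQES

variable (𝒮 : SKQES) {b b' : ℕ}

/-- The effective attack `E_k [Dec_k ∘ Λ ∘ Enc_k]`. -/
def effective (n : ℕ) (Λ : SuperOp (Bits (𝒮.c n) × Bits b) (Bits (𝒮.c n) × Bits b')) :
    SuperOp (Bits (𝒮.m n) × Bits b) (Option (Bits (𝒮.m n)) × Bits b') :=
  fun ρ => 𝒮.keyAvg n fun k => ampl (𝒮.Dec n k) (Λ (ampl (𝒮.Enc n k) ρ))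

/-- The simulator `id_M ⊗ Λ^acc + |⊥⟩⟨⊥| ⊗ Λ^reject`. -/
def simulator (D : Characterization 𝒮) (n : ℕ)
    (Λ : SuperOp (Bits (𝒮.c n) × Bits b) (Bits (𝒮.c n) × Bits b')) :
    SuperOp (Bits (𝒮.m n) × Bits b) (Option (Bits (𝒮.m n)) × Bits b') :=
  acceptOrReject
    (fun Z => 𝒮.keyAvg n fun k => ∑ r, (D.form n k).prob r • (D.form n k).simAcc Λ r Z)
    (fun Z => 𝒮.keyAvg n fun k => ∑ r, (D.form n k).prob r • (D.form n k).simRej Λ r Z)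

/-- Computational ciphertext authentication (cQCA): for every efficient attack map `Λ`, no QPT
algorithm that prepares the registers `M B` and then receives the output registers distinguishes
the effective attack from the simulator. (The attack may act trivially on a part of `B`, which then
is a reference system.) -/
def IsCQCA (D : Characterization 𝒮) : Prop :=
  ∀ (b b' : ℕ → ℕ) (Λ : ∀ n, Circ (𝒮.c n + b n) (𝒮.c n + b' n)), QPT Λ →
  ∀ A₁ : ∀ n, Circ 0 (𝒮.m n + b n), QPT A₁ →
  ∀ A₃ : ∀ n, Circ (𝒮.m n + 1 + b' n) 1, QPT A₃ →
    Negligible fun n =>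
      |(A₃ n).probOne (ampl toQubits
          (𝒮.effective n (Λ n).run₂ (split _ _ (A₁ n).prepare))) -
        (A₃ n).probOne (ampl toQubits
          (𝒮.simulator D n (Λ n).run₂ (split _ _ (A₁ n).prepare)))|

/-- The map on `M B` obtained in the ideal experiment by an encryption query with `M`, the map `Λ`
on the answer and `B`, and a decryption query with the resulting ciphertext register; at the end
the challenger's memory is discarded. -/
def idealRoundTrip (D : Characterization 𝒮) (n : ℕ)
    (Λ : SuperOp (Bits (𝒮.c n) × Bits b) (Bits (𝒮.c n) × Bits b')) :
    SuperOp (Bits (𝒮.m n) × Bits b) (Option (Bits (𝒮.m n)) × Bits b') :=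
  fun ρ => 𝒮.keyAvg n fun k => ∑ r, (D.form n k).prob r •
    (((D.form n k).idealDec [(Fin.last 0, r)]
      (ampl Λ ((D.form n k).idealEnc (l := 0) r (Matrix.of fun u v => ρ u.1 v.1)))).map
        fun o => trRight o.2).sum

end SKQES

end QuantumAE

end

noncomputable section

namespace QuantumAE

open Turing StateTransition Function
open scoped Kronecker BigOperators

/-! Let an adversary prepare `MB`, encrypt `M`, apply the attack to the ciphertext and `B`, decrypt,
and run the distinguisher on the result (`attacker`). In the real experiment it outputs 1 with
exactly the probability obtained from the effective attack (`qaeReal_attacker`), in the ideal one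
with exactly the probability obtained from the simulator (`qaeIdeal_attacker`). The advantage
against cQCA is therefore an advantage against QAE, without loss.

The ideal half rests on the exact identity `idealRoundTrip_eq_simulator`. The ideal encryption
oracle only stores `M` and encrypts half of a maximally entangled pair, so each matrix block of the
state with respect to the stored `M` is the attacked state of the simulator (`hblock` in
`roundTrip_eq`). Let P be the tag test and Q the entanglement test of the decryption oracle. They
act on different registers, so PQ = QP is the projector onto `Phi`. All tested registers are
discarded, so only traces matter, and by cyclicity acceptance has effect PQ and the two ways of
rejecting add up to 1 - PQ (`trace_accept`, `trace_reject`). These are the weights in `simAcc` and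
`simRej`. Linearity carries the identity through the averages over randomness and key.

It remains that the attacker is a uniform family. Its description is built from the descriptions of
three circuit families by concatenation and by prepending tokens, so polynomial time must be closed
under both operations (`PolyTime.append`, `PolyTime.cons`). This is shown by explicit constructions
on stack machines. -/

/-! ### Simulating a stack machine inside a larger one -/

section StackMachines

variable {K K' : Type} [DecidableEq K] [DecidableEq K'] {Γ : K → Type} {Γ' : K' → Type}
  {Λ Λ' σ σ' τ : Type}

/-- A statement of a stack machine, as a statement of a machine with more stacks, labels and
variables; instead of halting it jumps to the label `exit`. -/
def liftStmt (ι : K → K') (e : σ' ≃ σ × τ) (lab : Λ → Λ') (exit : Λ') :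
    TM2.Stmt (fun k => Γ' (ι k)) Λ σ → TM2.Stmt Γ' Λ' σ'
  | .push k f q => .push (ι k) (fun v => f (e v).1) (liftStmt ι e lab exit q)
  | .peek k f q => .peek (ι k) (fun v a => e.symm (f (e v).1 a, (e v).2)) (liftStmt ι e lab exit q)
  | .pop k f q => .pop (ι k) (fun v a => e.symm (f (e v).1 a, (e v).2)) (liftStmt ι e lab exit q)
  | .load f q => .load (fun v => e.symm (f (e v).1, (e v).2)) (liftStmt ι e lab exit q)
  | .branch f q₁ q₂ =>
      .branch (fun v => f (e v).1) (liftStmt ι e lab exit q₁) (liftStmt ι e lab exit q₂)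
  | .goto f => .goto fun v => lab (f (e v).1)
  | .halt => .goto fun _ => exit

/-- The configuration of the larger machine that simulates a given configuration. -/
def liftCfg {ι : K → K'} (e : σ' ≃ σ × τ) (lab : Λ → Λ') (exit : Λ')
    (emb : (∀ k, List (Γ' (ι k))) → ∀ k, List (Γ' k)) (x : τ)
    (c : TM2.Cfg (fun k => Γ' (ι k)) Λ σ) : TM2.Cfg Γ' Λ' σ' :=
  ⟨some (c.l.elim exit lab), e.symm (c.var, x), emb c.stk⟩

/-- `emb` fills in fixed contents for the stacks that the small machine does not own. `hread` and
`hupd` say that it is transparent to reading and writing on the owned ones, which is all that a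
statement can do. -/
theorem stepAux_liftStmt {ι : K → K'} (e : σ' ≃ σ × τ) (lab : Λ → Λ') (exit : Λ')
    {emb : (∀ k, List (Γ' (ι k))) → ∀ k, List (Γ' k)}
    (hread : ∀ S k, emb S (ι k) = S k)
    (hupd : ∀ S k a, update (emb S) (ι k) a = emb (update S k a)) (x : τ)
    (q : TM2.Stmt (fun k => Γ' (ι k)) Λ σ) (v : σ) (S : ∀ k, List (Γ' (ι k))) :
    TM2.stepAux (liftStmt ι e lab exit q) (e.symm (v, x)) (emb S) =
      liftCfg e lab exit emb x (TM2.stepAux q v S) := by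
  induction q generalizing v S with
  | push k f q ih => simp [liftStmt, hread, hupd, ih]
  | peek k f q ih => simp [liftStmt, hread, ih]
  | pop k f q ih => simp [liftStmt, hread, hupd, ih]
  | load f q ih => simp [liftStmt, ih]
  | branch f q₁ q₂ ih₁ ih₂ => cases h : f v <;> simp [liftStmt, h, ih₁, ih₂]
  | goto f => simp [liftStmt, liftCfg]
  | halt => simp [liftStmt, liftCfg]

/-- `f` leads from `a` to `b` in at most `m` steps. -/
def LeadsTo {α : Type} (f : α → Option α) (a b : α) (m : ℕ) : Prop :=
  ∃ n ≤ m, (flip bind f)^[n] (some a) = some b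

theorem LeadsTo.trans {α : Type} {f : α → Option α} {a b c : α} {m m' : ℕ}
    (h : LeadsTo f a b m) (h' : LeadsTo f b c m') : LeadsTo f a c (m + m') := by
  obtain ⟨n, hn, e⟩ := h
  obtain ⟨n', hn', e'⟩ := h'
  exact ⟨n' + n, by omega, by rw [iterate_add_apply, e, e']⟩

theorem LeadsTo.mono {α : Type} {f : α → Option α} {a b : α} {m m' : ℕ}
    (h : LeadsTo f a b m) (hm : m ≤ m') : LeadsTo f a b m' := by
  obtain ⟨n, hn, e⟩ := h
  exact ⟨n, hn.trans hm, e⟩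

theorem LeadsTo.refl {α : Type} (f : α → Option α) (a : α) : LeadsTo f a a 0 := ⟨0, le_rfl, rfl⟩

theorem LeadsTo.head {α : Type} {f : α → Option α} {a b c : α} {m : ℕ}
    (h : f a = some b) (h' : LeadsTo f b c m) : LeadsTo f a c (m + 1) := by
  obtain ⟨n, hn, e⟩ := h'
  refine ⟨n + 1, by omega, ?_⟩
  rw [iterate_succ_apply]
  simpa [flip, h] using e

theorem iterate_bind_none {α : Type} (f : α → Option α) (n : ℕ) :
    (flip bind f)^[n] none = none := by
  induction n with
  | zero => rfl
  | succ n ih => rw [iterate_succ_apply]; exact ih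

/-- Halting becomes a jump to `exit` within the same step, so the time bound is unchanged and the
next phase can start at `exit`. -/
theorem leadsTo_liftCfg {ι : K → K'} (e : σ' ≃ σ × τ) (lab : Λ → Λ') (exit : Λ')
    {emb : (∀ k, List (Γ' (ι k))) → ∀ k, List (Γ' k)}
    (hread : ∀ S k, emb S (ι k) = S k)
    (hupd : ∀ S k a, update (emb S) (ι k) a = emb (update S k a)) (x : τ)
    {M : Λ → TM2.Stmt (fun k => Γ' (ι k)) Λ σ} {M' : Λ' → TM2.Stmt Γ' Λ' σ'}
    (hM : ∀ l, M' (lab l) = liftStmt ι e lab exit (M l))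
    {c d : TM2.Cfg (fun k => Γ' (ι k)) Λ σ} {m : ℕ} (h : LeadsTo (TM2.step M) c d m) :
    LeadsTo (TM2.step M') (liftCfg e lab exit emb x c) (liftCfg e lab exit emb x d) m := by
  obtain ⟨n, hn, h⟩ := h
  refine LeadsTo.mono ?_ hn
  clear hn
  induction n generalizing c with
  | zero =>
    simp only [iterate_zero, id_eq, Option.some.injEq] at h
    exact h ▸ LeadsTo.refl _ _
  | succ n ih =>
    obtain ⟨_ | l, v, S⟩ := c
    · rw [iterate_succ_apply, show flip bind (TM2.step M) (some ⟨none, v, S⟩) = none from rfl,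
        iterate_bind_none] at h
      cases h
    · rw [iterate_succ_apply] at h
      refine LeadsTo.head ?_ (ih h)
      simp only [liftCfg, Option.elim_some, TM2.step, hM]
      rw [stepAux_liftStmt e lab exit hread hupd]
      rfl

/-- The number of push instructions in a statement. -/
def numPush : TM2.Stmt Γ Λ σ → ℕ
  | .push _ _ q => numPush q + 1
  | .peek _ _ q => numPush q
  | .pop _ _ q => numPush q
  | .load _ q => numPush q
  -- The sum serves as a crude bound for the maximum of the two branches.
  | .branch _ q₁ q₂ => numPush q₁ + numPush q₂
  | .goto _ => 0
  | .halt => 0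

theorem length_stepAux_le (q : TM2.Stmt Γ Λ σ) (v : σ) (S : ∀ k, List (Γ k)) (k : K) :
    ((TM2.stepAux q v S).stk k).length ≤ (S k).length + numPush q := by
  induction q generalizing v S with
  | push j f q ih =>
    refine (ih _ _).trans ?_
    obtain rfl | h := eq_or_ne k j
    · simp [numPush]; omega
    · simp [numPush, h]
  | peek j f q ih => exact ih _ _
  | pop j f q ih =>
    refine (ih _ _).trans ?_
    obtain rfl | h := eq_or_ne k j
    · simp [numPush]
    · simp [numPush, h]
  | load f q ih => exact ih _ _
  | branch f q₁ q₂ ih₁ ih₂ =>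
    have h₁ := ih₁ v S
    have h₂ := ih₂ v S
    cases h : f v <;> simp [numPush, h] <;> omega
  | goto f => simp [numPush]
  | halt => simp [numPush]

/-- A machine cannot write more than its running time allows. This bounds the cost of moving the
output of one machine elsewhere. -/
theorem LeadsTo.length_le [Fintype Λ] {M : Λ → TM2.Stmt Γ Λ σ} {c d : TM2.Cfg Γ Λ σ} {m : ℕ}
    (h : LeadsTo (TM2.step M) c d m) (k : K) :
    (d.stk k).length ≤ (c.stk k).length + m * ∑ l, numPush (M l) := by
  obtain ⟨n, hn, h⟩ := h
  refine le_trans ?_ (Nat.add_le_add_left (Nat.mul_le_mul_right _ hn) _)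
  clear hn
  induction n generalizing c with
  | zero =>
    simp only [iterate_zero, id_eq, Option.some.injEq] at h
    simp [h]
  | succ n ih =>
    obtain ⟨_ | l, v, S⟩ := c
    · rw [iterate_succ_apply, show flip bind (TM2.step M) (some ⟨none, v, S⟩) = none from rfl,
        iterate_bind_none] at h
      cases h
    · rw [iterate_succ_apply] at h
      refine (ih h).trans ?_
      have h₁ := length_stepAux_le (M l) v S k
      have h₂ : numPush (M l) ≤ ∑ l, numPush (M l) :=
        Finset.single_le_sum (f := fun l => numPush (M l)) (fun _ _ => Nat.zero_le _)
          (Finset.mem_univ l)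
      rw [add_mul, one_mul]
      dsimp only
      omega

end StackMachines

/-! ### Concatenating the outputs of two machines -/

section Append

variable {K₁ K₂ : Type} [DecidableEq K₁] [DecidableEq K₂] {Γ₁ : K₁ → Type} {Γ₂ : K₂ → Type}
  {Λ₁ Λ₂ σ₁ σ₂ β : Type}

/-- Alphabets of the stacks of two machines, of an input stack and of a scratch stack. -/
abbrev appendΓ (Γ₁ : K₁ → Type) (Γ₂ : K₂ → Type) (β : Type) : K₁ ⊕ K₂ ⊕ Bool → Type
  | .inl k => Γ₁ k
  | .inr (.inl k) => Γ₂ k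
  | .inr (.inr true) => Bool
  | .inr (.inr false) => β

/-- The contents of all stacks. -/
def appendStk (S₁ : ∀ k, List (Γ₁ k)) (S₂ : ∀ k, List (Γ₂ k)) (a : List Bool) (b : List β) :
    ∀ k, List (appendΓ Γ₁ Γ₂ β k)
  | .inl k => S₁ k
  | .inr (.inl k) => S₂ k
  | .inr (.inr true) => a
  | .inr (.inr false) => b

section

variable (S₁ : ∀ k, List (Γ₁ k)) (S₂ : ∀ k, List (Γ₂ k)) (a : List Bool) (b : List β)

theorem update_appendStk_inl (k : K₁) (x : List (Γ₁ k)) :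
    update (appendStk S₁ S₂ a b) (.inl k) x = appendStk (update S₁ k x) S₂ a b := by
  funext j
  rcases j with j | j | _ | _
  · obtain rfl | h := eq_or_ne j k
    · simp [appendStk]
    · rw [update_of_ne (by simpa using h)]; simp [appendStk, h]
  all_goals rw [update_of_ne (by simp)]; rfl

theorem update_appendStk_inr (k : K₂) (x : List (Γ₂ k)) :
    update (appendStk S₁ S₂ a b) (.inr (.inl k)) x = appendStk S₁ (update S₂ k x) a b := by
  funext j
  rcases j with j | j | _ | _
  · rw [update_of_ne (by simp)]; rfl
  · obtain rfl | h := eq_or_ne j k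
    · simp [appendStk]
    · rw [update_of_ne (by simpa using h)]; simp [appendStk, h]
  all_goals rw [update_of_ne (by simp)]; rfl

theorem update_appendStk_input (x : List Bool) :
    update (appendStk S₁ S₂ a b) (.inr (.inr true)) x = appendStk S₁ S₂ x b := by
  funext j
  rcases j with j | j | _ | _
  case inr.inr.true => exact update_self ..
  all_goals rw [update_of_ne (by simp)]; rfl

theorem update_appendStk_scratch (x : List β) :
    update (appendStk S₁ S₂ a b) (.inr (.inr false)) x = appendStk S₁ S₂ a x := by
  funext j
  rcases j with j | j | _ | _
  case inr.inr.false => exact update_self ..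
  all_goals rw [update_of_ne (by simp)]; rfl

end

variable [Inhabited β] {k₁ : K₁} {k₂ : K₂} {o₁ : K₁} {o₂ : K₂}

/-- Regrouping of the variables of the combined machine. -/
def sndVars (σ₁ σ₂ τ : Type) : σ₁ × σ₂ × τ ≃ σ₂ × σ₁ × τ where
  toFun v := (v.2.1, v.1, v.2.2)
  invFun v := (v.2.1, v.1, v.2.2)
  left_inv _ := rfl
  right_inv _ := rfl

/-- The program that copies its unary input to both machines, runs the first and the second
machine, and moves the output of the first one (through the scratch stack) on top of the output of
the second one. -/
def appendProg (M₁ : Λ₁ → TM2.Stmt Γ₁ Λ₁ σ₁) (M₂ : Λ₂ → TM2.Stmt Γ₂ Λ₂ σ₂)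
    (main₁ : Λ₁) (main₂ : Λ₂) (a₁ : Γ₁ k₁) (a₂ : Γ₂ k₂) (out₁ : Γ₁ o₁ → β) (out₂ : β → Γ₂ o₂) :
    Λ₁ ⊕ Λ₂ ⊕ Fin 3 →
      TM2.Stmt (appendΓ Γ₁ Γ₂ β) (Λ₁ ⊕ Λ₂ ⊕ Fin 3) (σ₁ × σ₂ × Option β)
  | .inl l => liftStmt (Γ' := appendΓ Γ₁ Γ₂ β) Sum.inl (Equiv.refl _) Sum.inl
      (.inr (.inl main₂)) (M₁ l)
  | .inr (.inl l) => liftStmt (Γ' := appendΓ Γ₁ Γ₂ β) (fun k => .inr (.inl k))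
      (sndVars σ₁ σ₂ (Option β)) (fun l => .inr (.inl l)) (.inr (.inr 1)) (M₂ l)
  -- Copying loop. The popped symbol is replaced by `default`, since only whether there was one
  -- matters for unary input.
  | .inr (.inr 0) =>
      .pop (.inr (.inr true)) (fun v a => (v.1, v.2.1, Option.map (fun _ => default) a)) <|
      .branch (fun v => v.2.2.isSome)
        (.push (.inl k₁) (fun _ => a₁) <| .push (.inr (.inl k₂)) (fun _ => a₂) <|
          .goto fun _ => .inr (.inr 0))
        (.goto fun _ => .inl main₁)
  -- Moving the output to the scratch stack reverses it; the last loop reverses it back. Popping the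
  -- empty stack at the end of a loop resets the buffer to `none`, so the machine halts in its
  -- initial variables, as `haltList` demands.
  | .inr (.inr 1) =>
      .pop (.inl o₁) (fun v a => (v.1, v.2.1, Option.map out₁ a)) <|
      .branch (fun v => v.2.2.isSome)
        (.push (.inr (.inr false)) (fun v => v.2.2.getD default) <| .goto fun _ => .inr (.inr 1))
        (.goto fun _ => .inr (.inr 2))
  | .inr (.inr 2) =>
      .pop (.inr (.inr false)) (fun v a => (v.1, v.2.1, a)) <|
      .branch (fun v => v.2.2.isSome)
        (.push (.inr (.inl o₂)) (fun v => out₂ (v.2.2.getD default)) <|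
          .goto fun _ => .inr (.inr 2))
        .halt

variable (M₁ : Λ₁ → TM2.Stmt Γ₁ Λ₁ σ₁) (M₂ : Λ₂ → TM2.Stmt Γ₂ Λ₂ σ₂)
    (main₁ : Λ₁) (main₂ : Λ₂) (a₁ : Γ₁ k₁) (a₂ : Γ₂ k₂) (out₁ : Γ₁ o₁ → β) (out₂ : β → Γ₂ o₂)
    (v₁ : σ₁) (v₂ : σ₂)

/-- A whole statement counts as one step, so each symbol costs one step, and one more step finds the
stack empty. The numbers `i`, `j` of symbols already copied are free for the induction. -/
theorem appendProg_copy (n i j : ℕ) (x : Option β) :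
    LeadsTo (TM2.step (appendProg M₁ M₂ main₁ main₂ a₁ a₂ out₁ out₂))
      ⟨some (.inr (.inr 0)), (v₁, v₂, x),
        appendStk (update (fun _ => []) k₁ (List.replicate i a₁))
          (update (fun _ => []) k₂ (List.replicate j a₂)) (List.replicate n true) []⟩
      ⟨some (.inl main₁), (v₁, v₂, none),
        appendStk (update (fun _ => []) k₁ (List.replicate (i + n) a₁))
          (update (fun _ => []) k₂ (List.replicate (j + n) a₂)) [] []⟩ (n + 1) := by
  induction n generalizing i j x with
  | zero =>
    refine LeadsTo.head ?_ (LeadsTo.refl _ _)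
    simp [appendProg, appendStk, update_appendStk_input]
  | succ n ih =>
    have := ih (i + 1) (j + 1) (some default)
    rw [add_assoc, add_assoc, add_comm 1 n] at this
    refine LeadsTo.head ?_ this
    simp [appendProg, appendStk, update_appendStk_input, update_appendStk_inl,
      update_appendStk_inr, List.replicate_succ]

theorem appendProg_reverse (L : List (Γ₁ o₁)) (S₂ : ∀ k, List (Γ₂ k)) (b : List β)
    (x : Option β) :
    LeadsTo (TM2.step (appendProg M₁ M₂ main₁ main₂ a₁ a₂ out₁ out₂))
      ⟨some (.inr (.inr 1)), (v₁, v₂, x), appendStk (update (fun _ => []) o₁ L) S₂ [] b⟩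
      ⟨some (.inr (.inr 2)), (v₁, v₂, none),
        appendStk (fun _ => []) S₂ [] ((L.map out₁).reverse ++ b)⟩ (L.length + 1) := by
  induction L generalizing b x with
  | nil =>
    refine LeadsTo.head ?_ (LeadsTo.refl _ _)
    simp [appendProg, appendStk, update_appendStk_inl]
  | cons y L ih =>
    have := ih (out₁ y :: b) (some (out₁ y))
    refine LeadsTo.head ?_ (by simpa using this)
    simp [appendProg, appendStk, update_appendStk_inl, update_appendStk_scratch]

theorem appendProg_unload (L : List β) (b : List (Γ₂ o₂)) (x : Option β) :
    LeadsTo (TM2.step (appendProg M₁ M₂ main₁ main₂ a₁ a₂ out₁ out₂))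
      ⟨some (.inr (.inr 2)), (v₁, v₂, x),
        appendStk (fun _ => []) (update (fun _ => []) o₂ b) [] L⟩
      ⟨none, (v₁, v₂, none),
        appendStk (fun _ => []) (update (fun _ => []) o₂ ((L.map out₂).reverse ++ b)) [] []⟩
      (L.length + 1) := by
  induction L generalizing b x with
  | nil =>
    refine LeadsTo.head ?_ (LeadsTo.refl _ _)
    simp [appendProg, appendStk, update_appendStk_scratch]
  | cons y L ih =>
    have := ih (out₂ y :: b) (some y)
    refine LeadsTo.head ?_ (by simpa using this)
    simp [appendProg, appendStk, update_appendStk_inr, update_appendStk_scratch]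

theorem appendProg_leadsTo {n m₁ m₂ : ℕ} {L₁ : List (Γ₁ o₁)} {L₂ : List (Γ₂ o₂)}
    (h₁ : LeadsTo (TM2.step M₁)
      ⟨some main₁, v₁, update (fun _ => []) k₁ (List.replicate n a₁)⟩
      ⟨none, v₁, update (fun _ => []) o₁ L₁⟩ m₁)
    (h₂ : LeadsTo (TM2.step M₂)
      ⟨some main₂, v₂, update (fun _ => []) k₂ (List.replicate n a₂)⟩
      ⟨none, v₂, update (fun _ => []) o₂ L₂⟩ m₂) :
    LeadsTo (TM2.step (appendProg M₁ M₂ main₁ main₂ a₁ a₂ out₁ out₂))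
      ⟨some (.inr (.inr 0)), (v₁, v₂, none),
        appendStk (fun _ => []) (fun _ => []) (List.replicate n true) []⟩
      ⟨none, (v₁, v₂, none),
        appendStk (fun _ => [])
          (update (fun _ => []) o₂ ((L₁.map out₁).map out₂ ++ L₂)) [] []⟩
      ((n + 1) + m₁ + m₂ + (L₁.length + 1) + (L₁.length + 1)) := by
  have c := appendProg_copy (β := β) M₁ M₂ main₁ main₂ a₁ a₂ out₁ out₂ v₁ v₂ n 0 0 none
  simp only [List.replicate_zero, update_eq_self_iff.2, zero_add] at c
  -- While the first machine runs, the frame holds the waiting input of the second; in `r₂` it holds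
  -- the finished output of the first.
  have r₁ := leadsTo_liftCfg (ι := Sum.inl) (Γ' := appendΓ Γ₁ Γ₂ β)
    (Equiv.refl (σ₁ × (σ₂ × Option β))) Sum.inl
    (.inr (.inl main₂)) (emb := fun S => appendStk S (update (fun _ => []) k₂
      (List.replicate n a₂)) [] [])
    (fun _ _ => rfl) (fun _ _ _ => update_appendStk_inl ..) (v₂, none) (M := M₁)
    (M' := appendProg M₁ M₂ main₁ main₂ a₁ a₂ out₁ out₂) (fun _ => rfl) h₁
  have r₂ := leadsTo_liftCfg (ι := fun k => Sum.inr (Sum.inl k)) (Γ' := appendΓ Γ₁ Γ₂ β)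
    (sndVars σ₁ σ₂ (Option β)) (fun l => .inr (.inl l))
    (.inr (.inr 1)) (emb := fun S => appendStk (update (fun _ => []) o₁ L₁) S [] [])
    (fun _ _ => rfl) (fun _ _ _ => update_appendStk_inr ..) (v₁, none) (M := M₂)
    (M' := appendProg M₁ M₂ main₁ main₂ a₁ a₂ out₁ out₂) (fun _ => rfl) h₂
  have s := appendProg_reverse M₁ M₂ main₁ main₂ a₁ a₂ out₁ out₂ v₁ v₂ L₁
    (update (fun _ => []) o₂ L₂) [] none
  have u := appendProg_unload M₁ M₂ main₁ main₂ a₁ a₂ out₁ out₂ v₁ v₂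
    ((L₁.map out₁).reverse ++ []) L₂ none
  have := (((c.trans r₁).trans r₂).trans s).trans u
  simpa using this

end Append

/-! ### Closure properties of polynomial-time computable token lists -/

theorem initList_eq (tm : FinTM2) (s : List (tm.Γ tm.k₀)) :
    initList tm s = ⟨some tm.main, tm.initialState, update (fun _ => []) tm.k₀ s⟩ := by
  unfold initList
  congr 1
  funext k
  by_cases h : k = tm.k₀
  · subst h; simp
  · simp [h]

theorem haltList_eq (tm : FinTM2) (s : List (tm.Γ tm.k₁)) :
    haltList tm s = ⟨none, tm.initialState, update (fun _ => []) tm.k₁ s⟩ := by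
  unfold haltList
  congr 1
  funext k
  by_cases h : k = tm.k₁
  · subst h; simp
  · simp [h]

theorem unaryEncodeNat_eq_replicate (n : ℕ) :
    Computability.unaryEncodeNat n = List.replicate n true := by
  induction n with
  | zero => rfl
  | succ n ih => rw [Computability.unaryEncodeNat, ih, List.replicate_succ]

/-- `f` is computed from unary input by the program of `tm`, in time `p`. -/
def Computes {β : Type} (tm : FinTM2) (a : tm.Γ tm.k₀) (out : β → tm.Γ tm.k₁) (f : ℕ → List β)
    (p : Polynomial ℕ) : Prop :=
  ∀ n, LeadsTo (TM2.step tm.m)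
    ⟨some tm.main, tm.initialState, update (fun _ => []) tm.k₀ (List.replicate n a)⟩
    ⟨none, tm.initialState, update (fun _ => []) tm.k₁ ((f n).map out)⟩ (p.eval n)

/-- The input is unary: its length is `n`, so the time polynomial is evaluated at `n`, and only the
code of `true` ever occurs on the input stack. -/
theorem polyTime_iff (f : ℕ → List Tok) :
    PolyTime f ↔ ∃ (tm : FinTM2) (i : tm.Γ tm.k₀ ≃ Bool) (o : tm.Γ tm.k₁ ≃ Tok)
      (p : Polynomial ℕ), Computes tm (i.symm true) o.symm f p := by
  constructor
  · rintro ⟨⟨⟨tm, i, o⟩, p, h⟩⟩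
    refine ⟨tm, i, o, p, fun n => ?_⟩
    obtain ⟨⟨k, hk⟩, hle⟩ := h n
    simp only [unaryEncodeNat_eq_replicate, initList_eq, haltList_eq, List.map_replicate,
      Option.map_some, List.length_replicate] at hk hle
    exact ⟨k, hle, hk⟩
  · rintro ⟨tm, i, o, p, h⟩
    refine ⟨⟨⟨tm, i, o⟩, p, fun n => ?_⟩⟩
    choose k hle hk using h n
    refine ⟨⟨k, ?_⟩, ?_⟩
    · simp only [unaryEncodeNat_eq_replicate, initList_eq, haltList_eq, List.map_replicate,
        Option.map_some]
      exact hk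
    · simpa only [unaryEncodeNat_eq_replicate, List.length_replicate] using hle

/-- The combined machine buffers a token in its variables, whose state space must be finite. -/
instance : Finite Tok :=
  Finite.of_surjective
    (![Tok.one, Tok.sep, Tok.had, Tok.tee, Tok.cnot, Tok.enc, Tok.dec, Tok.fin] : Fin 8 → Tok)
    (by
      rintro (_ | _ | _ | _ | _ | _ | _ | _)
      exacts [⟨0, rfl⟩, ⟨1, rfl⟩, ⟨2, rfl⟩, ⟨3, rfl⟩, ⟨4, rfl⟩, ⟨5, rfl⟩, ⟨6, rfl⟩, ⟨7, rfl⟩])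

instance : Inhabited Tok := ⟨Tok.one⟩

/-- Polynomial-time computable token lists can be concatenated. -/
theorem PolyTime.append {f g : ℕ → List Tok} (hf : PolyTime f) (hg : PolyTime g) :
    PolyTime fun n => f n ++ g n := by
  rw [polyTime_iff] at hf hg ⊢
  obtain ⟨tm₁, i₁, o₁, p₁, h₁⟩ := hf
  obtain ⟨tm₂, i₂, o₂, p₂, h₂⟩ := hg
  let _ := Fintype.ofFinite Tok
  let _ := tm₁.ΛFin
  let _ := tm₂.ΛFin
  let _ := tm₁.σFin
  let _ := tm₂.σFin
  let _ := tm₁.kFin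
  let _ := tm₂.kFin
  let tm : FinTM2 :=
    { K := tm₁.K ⊕ tm₂.K ⊕ Bool
      k₀ := .inr (.inr true)
      k₁ := .inr (.inl tm₂.k₁)
      Γ := appendΓ tm₁.Γ tm₂.Γ Tok
      Λ := tm₁.Λ ⊕ tm₂.Λ ⊕ Fin 3
      main := .inr (.inr 0)
      σ := tm₁.σ × tm₂.σ × Option Tok
      initialState := (tm₁.initialState, tm₂.initialState, none)
      Γk₀Fin := inferInstanceAs (Fintype Bool)
      m := appendProg tm₁.m tm₂.m tm₁.main tm₂.main (i₁.symm true) (i₂.symm true) o₁ o₂.symm }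
  let B := ∑ l, numPush (tm₁.m l)
  -- Copying takes n + 1 steps, the two machines take `p₁` and `p₂`, and each of the two moving
  -- loops takes one step more than the length of the first output, which is at most n + `p₁` * `B`.
  refine ⟨tm, Equiv.refl Bool, o₂, Polynomial.X + 1 + p₁ + p₂ +
    2 * (Polynomial.X + p₁ * Polynomial.C B + 1), fun n => ?_⟩
  have h := appendProg_leadsTo tm₁.m tm₂.m tm₁.main tm₂.main (i₁.symm true) (i₂.symm true)
    o₁ o₂.symm tm₁.initialState tm₂.initialState (h₁ n) (h₂ n)
  have hlen : (f n).length ≤ n + p₁.eval n * B := by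
    have hl := (h₁ n).length_le tm₁.k₁
    simp only [update_self, List.length_map] at hl
    refine hl.trans (Nat.add_le_add_right ?_ _)
    -- If the first machine uses one stack for input and output, that stack starts with `n` symbols;
    -- otherwise its output stack starts empty.
    by_cases hk : tm₁.k₁ = tm₁.k₀
    · rw [hk]; simp
    · simp [hk]
  have hin : update (fun _ => [] : ∀ k, List (tm.Γ k)) tm.k₀ (List.replicate n true) =
      appendStk (fun _ => []) (fun _ => []) (List.replicate n true) [] := by
    rw [← update_appendStk_input (fun _ => []) (fun _ => []) []]
    congr 1
    funext k
    rcases k with k | k | _ | _ <;> rfl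
  have hout : update (fun _ => [] : ∀ k, List (tm.Γ k)) tm.k₁ ((f n ++ g n).map o₂.symm) =
      appendStk (fun _ => []) (update (fun _ => []) tm₂.k₁
        ((((f n).map o₁.symm).map o₁).map o₂.symm ++ (g n).map o₂.symm)) [] [] := by
    rw [← update_appendStk_inr]
    simp only [List.map_map, Equiv.self_comp_symm, List.map_append,
      Function.comp_id]
    congr 1
    funext k
    rcases k with k | k | _ | _ <;> rfl
  refine LeadsTo.mono
    (m := (n + 1) + p₁.eval n + p₂.eval n + ((f n).length + 1) + ((f n).length + 1)) ?_ ?_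
  · simp only [List.length_map] at h
    rw [← hout] at h
    exact (congrArg (fun S => LeadsTo (TM2.step tm.m) ⟨some tm.main, tm.initialState, S⟩
      ⟨none, tm.initialState, _⟩ _) hin).mpr h
  · simp only [Polynomial.eval_add, Polynomial.eval_mul, Polynomial.eval_X, Polynomial.eval_one,
      Polynomial.eval_C, Polynomial.eval_ofNat]
    omega

/-- A statement modified so that a symbol is pushed before halting. -/
def pushAtHalt {K : Type} {Γ : K → Type} {Λ σ : Type} (k : K) (t : Γ k) :
    TM2.Stmt Γ Λ σ → TM2.Stmt Γ Λ σ
  | .push j f q => .push j f (pushAtHalt k t q)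
  | .peek j f q => .peek j f (pushAtHalt k t q)
  | .pop j f q => .pop j f (pushAtHalt k t q)
  | .load f q => .load f (pushAtHalt k t q)
  | .branch f q₁ q₂ => .branch f (pushAtHalt k t q₁) (pushAtHalt k t q₂)
  | .goto f => .goto f
  | .halt => .push k (fun _ => t) .halt

/-- A configuration with a symbol pushed if it is halted. -/
def pushIfHalted {K : Type} [DecidableEq K] {Γ : K → Type} {Λ σ : Type} (k : K) (t : Γ k)
    (c : TM2.Cfg Γ Λ σ) : TM2.Cfg Γ Λ σ :=
  match c.l with
  | none => ⟨none, c.var, update c.stk k (t :: c.stk k)⟩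
  | some _ => c

theorem stepAux_pushAtHalt {K : Type} [DecidableEq K] {Γ : K → Type} {Λ σ : Type} (k : K)
    (t : Γ k) (q : TM2.Stmt Γ Λ σ) (v : σ) (S : ∀ k, List (Γ k)) :
    TM2.stepAux (pushAtHalt k t q) v S = pushIfHalted k t (TM2.stepAux q v S) := by
  induction q generalizing v S with
  | branch f q₁ q₂ ih₁ ih₂ => cases h : f v <;> simp [pushAtHalt, h, ih₁, ih₂]
  | goto f => rfl
  | halt => rfl
  | _ => simp [pushAtHalt, *]

/-- The additional push belongs to the statement that halts, so it costs no step, and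
`PolyTime.cons` keeps the same time polynomial. -/
theorem LeadsTo.pushAtHalt {K : Type} [DecidableEq K] {Γ : K → Type} {Λ σ : Type} (k : K)
    (t : Γ k) {M : Λ → TM2.Stmt Γ Λ σ} {c d : TM2.Cfg Γ Λ σ} {m : ℕ}
    (h : LeadsTo (TM2.step M) c d m) :
    LeadsTo (TM2.step fun l => pushAtHalt k t (M l)) (pushIfHalted k t c) (pushIfHalted k t d)
      m := by
  obtain ⟨n, hn, h⟩ := h
  refine LeadsTo.mono ?_ hn
  clear hn
  induction n generalizing c with
  | zero =>
    simp only [iterate_zero, id_eq, Option.some.injEq] at h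
    exact h ▸ LeadsTo.refl _ _
  | succ n ih =>
    obtain ⟨_ | l, v, S⟩ := c
    · rw [iterate_succ_apply, show flip bind (TM2.step M) (some ⟨none, v, S⟩) = none from rfl,
        iterate_bind_none] at h
      cases h
    · rw [iterate_succ_apply] at h
      refine LeadsTo.head ?_ (ih h)
      simp only [pushIfHalted, TM2.step, stepAux_pushAtHalt]

/-- A token can be prepended to a polynomial-time computable token list. -/
theorem PolyTime.cons {f : ℕ → List Tok} (t : Tok) (hf : PolyTime f) :
    PolyTime fun n => t :: f n := by
  rw [polyTime_iff] at hf ⊢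
  obtain ⟨tm, i, o, p, h⟩ := hf
  refine ⟨{ tm with m := fun l => pushAtHalt tm.k₁ (o.symm t) (tm.m l) }, i, o, p, fun n => ?_⟩
  have := (h n).pushAtHalt tm.k₁ (o.symm t)
  simpa [pushIfHalted] using this

/-! ### Projectors of the simulator -/

section Projectors

variable {m t c : ℕ} (F : EncForm m t c) (r : Bits t)

/-- The projector onto `|ψ r⟩` on the tag register of `(M' T) M''`. -/
def EncForm.tagProj : Op ((Bits m × Bits t) × Bits m) :=
  ((1 : Op (Bits m)) ⊗ₖ F.proj r) ⊗ₖ (1 : Op (Bits m))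

/-- The projector onto the maximally entangled state of `M' M''` on `(M' T) M''`. -/
def entProj (m t : ℕ) : Op ((Bits m × Bits t) × Bits m) :=
  Matrix.of fun u v => if u.1.2 = v.1.2 then phiPlus m (u.1.1, u.2) (v.1.1, v.2) else 0

/-- The projector `|Φ_r⟩⟨Φ_r|`. -/
def EncForm.phiProj : Op ((Bits m × Bits t) × Bits m) :=
  Matrix.vecMulVec (F.Phi r) (star (F.Phi r))

theorem EncForm.proj_mul_proj : F.proj r * F.proj r = F.proj r := by
  have h : star (F.ψ r) ⬝ᵥ F.ψ r = 1 := by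
    have := F.ψ_orthonormal r r
    simpa [dotProduct] using this
  rw [EncForm.proj, Matrix.vecMulVec_mul_vecMulVec, h, one_smul]

theorem EncForm.tagProj_mul_tagProj : F.tagProj r * F.tagProj r = F.tagProj r := by
  simp only [EncForm.tagProj, ← Matrix.mul_kronecker_mul, mul_one, F.proj_mul_proj]

theorem entProj_mul_entProj (m t : ℕ) : entProj m t * entProj m t = entProj m t := by
  ext ⟨⟨a, b⟩, d⟩ ⟨⟨a', b'⟩, d'⟩
  simp only [Matrix.mul_apply, entProj, Matrix.of_apply, Fintype.sum_prod_type, phiPlus]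
  by_cases h : a = d <;> by_cases h' : a' = d' <;> by_cases hb : b = b' <;>
    simp [h, h', hb, Finset.sum_ite_eq, Finset.sum_ite_eq']

theorem sqrt_two_pow_inv_mul_self (m : ℕ) :
    ((Real.sqrt (2 ^ m) : ℂ)⁻¹) * ((Real.sqrt (2 ^ m) : ℂ)⁻¹) = ((2 : ℂ) ^ m)⁻¹ := by
  rw [← mul_inv, ← Complex.ofReal_mul, Real.mul_self_sqrt (by positivity)]
  norm_num

theorem EncForm.phiProj_apply (u v : (Bits m × Bits t) × Bits m) :
    F.phiProj r u v = phiPlus m (u.1.1, u.2) (v.1.1, v.2) * F.proj r u.1.2 v.1.2 := by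
  simp only [EncForm.phiProj, Matrix.vecMulVec_apply, EncForm.Phi, phiPlus, Matrix.of_apply,
    EncForm.proj, Pi.star_apply]
  by_cases h : u.1.1 = u.2 <;> by_cases h' : v.1.1 = v.2 <;> simp [h, h']
  rw [← sqrt_two_pow_inv_mul_self]
  ring

/-- The two tests act on the disjoint registers `T` and `M' M''`, so their product, in either order,
is the tensor product of two rank-one projectors. -/
theorem EncForm.entProj_mul_tagProj : entProj m t * F.tagProj r = F.phiProj r := by
  ext ⟨⟨a, b⟩, d⟩ ⟨⟨a', b'⟩, d'⟩
  simp [Matrix.mul_apply, F.phiProj_apply, entProj, EncForm.tagProj, Fintype.sum_prod_type,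
    Matrix.one_apply]

theorem EncForm.tagProj_mul_entProj : F.tagProj r * entProj m t = F.phiProj r := by
  ext ⟨⟨a, b⟩, d⟩ ⟨⟨a', b'⟩, d'⟩
  simp [Matrix.mul_apply, F.phiProj_apply, entProj, EncForm.tagProj, Fintype.sum_prod_type,
    Matrix.one_apply, mul_comm]

theorem EncForm.tagProj_mul_phiProj : F.tagProj r * F.phiProj r = F.phiProj r := by
  rw [← F.tagProj_mul_entProj, ← mul_assoc, F.tagProj_mul_tagProj]

theorem EncForm.phiProj_mul_phiProj : F.phiProj r * F.phiProj r = F.phiProj r := by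
  calc F.phiProj r * F.phiProj r = entProj m t * F.tagProj r * F.phiProj r := by
        rw [F.entProj_mul_tagProj]
    _ = entProj m t * (entProj m t * F.tagProj r) := by
        rw [mul_assoc, F.tagProj_mul_phiProj, F.entProj_mul_tagProj]
    _ = F.phiProj r := by rw [← mul_assoc, entProj_mul_entProj, F.entProj_mul_tagProj]

/-- Both sandwiching products equal `phiProj`; cyclicity of the trace and idempotence leave a single
copy. -/
theorem EncForm.trace_accept (A : Op ((Bits m × Bits t) × Bits m)) :
    (entProj m t * (F.tagProj r * A * F.tagProj r) * entProj m t).trace =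
      (F.phiProj r * A).trace := by
  rw [show entProj m t * (F.tagProj r * A * F.tagProj r) * entProj m t =
      (entProj m t * F.tagProj r) * A * (F.tagProj r * entProj m t) by noncomm_ring,
    F.entProj_mul_tagProj, F.tagProj_mul_entProj, Matrix.trace_mul_comm, ← mul_assoc,
    F.phiProj_mul_phiProj]

/-- The summands are the failure of the tag test and the failure of the entanglement test after a
passed tag test. Under the trace their effects are 1 - P and P - PQ, with sum 1 - PQ. -/
theorem EncForm.trace_reject (A : Op ((Bits m × Bits t) × Bits m)) :
    ((1 - F.tagProj r) * A * (1 - F.tagProj r) +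
      (1 - entProj m t) * (F.tagProj r * A * F.tagProj r) * (1 - entProj m t)).trace =
      ((1 - F.phiProj r) * A).trace := by
  have h₁ : (1 - F.tagProj r) * (1 - F.tagProj r) = 1 - F.tagProj r := by
    simp [mul_sub, sub_mul, F.tagProj_mul_tagProj]
  have h₂ : F.tagProj r * (1 - entProj m t) * ((1 - entProj m t) * F.tagProj r) =
      F.tagProj r - F.phiProj r := by
    rw [mul_assoc, ← mul_assoc (1 - entProj m t)]
    simp [mul_sub, sub_mul, entProj_mul_entProj, F.tagProj_mul_tagProj, F.entProj_mul_tagProj,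
      F.tagProj_mul_phiProj]
  rw [show (1 - entProj m t) * (F.tagProj r * A * F.tagProj r) * (1 - entProj m t) =
      ((1 - entProj m t) * F.tagProj r) * A * (F.tagProj r * (1 - entProj m t)) by
        simp only [mul_assoc],
    Matrix.trace_add, Matrix.trace_mul_comm, ← mul_assoc, h₁, Matrix.trace_mul_comm _
      (F.tagProj r * (1 - entProj m t)), ← mul_assoc, h₂, ← Matrix.trace_add, ← add_mul,
    sub_add_sub_cancel]

end Projectors

/-! ### The ideal oracles with one memory slot -/

section OneSlot

variable {m t s : ℕ}

/-- An operator on `(M' T) M''` as an operator on all registers, with one memory slot. -/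
def onSlot (A : Op ((Bits m × Bits t) × Bits m)) :
    Op (((Bits m × Bits t) × Bits s) × Mem m (0 + 1)) :=
  Matrix.of fun u v => if u.1.2 = v.1.2 ∧ (u.2 (Fin.last 0)).2 = (v.2 (Fin.last 0)).2
    then A (u.1.1, (u.2 (Fin.last 0)).1) (v.1.1, (v.2 (Fin.last 0)).1) else 0

/-- The block of an operator on `(M' T) M''` for given basis states of the other registers. -/
def slotBlock (X : Op (((Bits m × Bits t) × Bits s) × Mem m (0 + 1))) (x y : Bits m) (z z' : Bits s) :
    Op ((Bits m × Bits t) × Bits m) :=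
  Matrix.of fun u v => X ((u.1, z), fun _ => (u.2, x)) ((v.1, z'), fun _ => (v.2, y))

/-- The index is written `0 + 1` because this is the number of slots in the result type of
`idealEnc` for `l = 0`. -/
theorem eq_last_zero (i : Fin (0 + 1)) : i = Fin.last 0 :=
  Subsingleton.elim (α := Fin 1) i _

theorem sum_mem_one {A : Type} [AddCommMonoid A] (f : Mem m (0 + 1) → A) :
    ∑ e, f e = ∑ a, ∑ x, f fun _ => (a, x) := by
  have h := (Equiv.funUnique (Fin 1) (Bits m × Bits m)).symm.sum_comp f
  rw [Fintype.sum_prod_type] at h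
  exact h.symm

theorem mem_one_ext_iff (e e' : Mem m (0 + 1)) :
    e = e' ↔ (e (Fin.last 0)).1 = (e' (Fin.last 0)).1 ∧
      (e (Fin.last 0)).2 = (e' (Fin.last 0)).2 := by
  rw [← Prod.ext_iff]
  refine ⟨fun h => h ▸ rfl, fun h => funext fun i => ?_⟩
  rwa [eq_last_zero i]

/-- An operator that is the identity on the stored `M` and on the side register acts on every block
separately. This reduces the decryption oracle to the operators on `(M' T) M''`. -/
theorem slotBlock_onSlot_mul (A : Op ((Bits m × Bits t) × Bits m))
    (X : Op (((Bits m × Bits t) × Bits s) × Mem m (0 + 1))) (x y : Bits m) (z z' : Bits s) :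
    slotBlock (onSlot A * X) x y z z' = A * slotBlock X x y z z' := by
  ext ⟨u, a⟩ ⟨v, b⟩
  simp only [slotBlock, onSlot, Matrix.mul_apply, Matrix.of_apply]
  simp only [Fintype.sum_prod_type, sum_mem_one]
  simp [ite_and]

theorem slotBlock_mul_onSlot (A : Op ((Bits m × Bits t) × Bits m))
    (X : Op (((Bits m × Bits t) × Bits s) × Mem m (0 + 1))) (x y : Bits m) (z z' : Bits s) :
    slotBlock (X * onSlot A) x y z z' = slotBlock X x y z z' * A := by
  ext ⟨u, a⟩ ⟨v, b⟩
  simp only [slotBlock, onSlot, Matrix.mul_apply, Matrix.of_apply]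
  simp only [Fintype.sum_prod_type, sum_mem_one]
  simp [ite_and]

theorem onSlot_one : (onSlot 1 : Op (((Bits m × Bits t) × Bits s) × Mem m (0 + 1))) = 1 := by
  ext ⟨⟨u, z⟩, e⟩ ⟨⟨v, z'⟩, e'⟩
  simp only [onSlot, Matrix.of_apply, Matrix.one_apply, Prod.mk.injEq, mem_one_ext_iff]
  split_ifs <;> tauto

theorem onSlot_sub (A B : Op ((Bits m × Bits t) × Bits m)) :
    (onSlot (A - B) : Op (((Bits m × Bits t) × Bits s) × Mem m (0 + 1))) = onSlot A - onSlot B := by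
  ext ⟨⟨u, z⟩, e⟩ ⟨⟨v, z'⟩, e'⟩
  simp only [onSlot, Matrix.of_apply, Matrix.sub_apply]
  split_ifs <;> simp

theorem slotBlock_add (X Y : Op (((Bits m × Bits t) × Bits s) × Mem m (0 + 1))) (x y : Bits m)
    (z z' : Bits s) :
    slotBlock (X + Y) x y z z' = slotBlock X x y z z' + slotBlock Y x y z z' := rfl

theorem EncForm.projTag_eq_onSlot {c : ℕ} (F : EncForm m t c) (r : Bits t) :
    (F.projTag r : Op (((Bits m × Bits t) × Bits s) × Mem m (0 + 1))) = onSlot (F.tagProj r) := by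
  ext ⟨⟨⟨a, b⟩, z⟩, e⟩ ⟨⟨⟨a', b'⟩, z'⟩, e'⟩
  simp only [EncForm.projTag, onSlot, EncForm.tagProj, Matrix.kroneckerMap_apply,
    Matrix.of_apply, Matrix.one_apply, mem_one_ext_iff]
  by_cases h : z = z' <;> by_cases h' : (e (Fin.last 0)).2 = (e' (Fin.last 0)).2 <;>
    by_cases h₁ : (e (Fin.last 0)).1 = (e' (Fin.last 0)).1 <;> simp_all

theorem projPlus_eq_onSlot :
    (projPlus (Fin.last 0) : Op (((Bits m × Bits t) × Bits s) × Mem m (0 + 1))) =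
      onSlot (entProj m t) := by
  ext ⟨⟨⟨a, b⟩, z⟩, e⟩ ⟨⟨⟨a', b'⟩, z'⟩, e'⟩
  have h : ∀ i : Fin (0 + 1), i ≠ Fin.last 0 → e i = e' i :=
    fun i hi => absurd (eq_last_zero i) hi
  simp only [projPlus, onSlot, entProj, Matrix.of_apply]
  split_ifs <;> tauto

/-- The vacated slot is in `|0⟩`, so tracing it out leaves one term. The sums over `M' T` and over
`M''` form the trace, while the stored `M` survives as the indices `x`, `y`. -/
theorem trRight_handOver_some (X : Op (((Bits m × Bits t) × Bits s) × Mem m (0 + 1))) (x y : Bits m)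
    (z z' : Bits s) :
    trRight (handOver (Fin.last 0) X) (some x, z) (some y, z') =
      (slotBlock X x y z z').trace := by
  have hupd : ∀ (a b x : Bits m), Function.update (fun _ => (a, b) : Mem m (0 + 1)) (Fin.last 0) (a, x) =
      fun _ => (a, x) := by
    intro a b x
    funext i
    rw [eq_last_zero i, Function.update_self]
  simp only [trRight, handOver, Matrix.of_apply, and_self, Matrix.trace, Matrix.diag_apply, slotBlock,
    sum_mem_one, hupd, Finset.sum_ite_eq', Finset.mem_univ, if_true]
  rw [Fintype.sum_prod_type_right]

/-- On rejection the stored `M` is discarded too, hence the sum over diagonal blocks. -/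
theorem trRight_rejectAns_none (X : Op (((Bits m × Bits t) × Bits s) × Mem m (0 + 1)))
    (z z' : Bits s) :
    trRight (rejectAns X) (none, z) (none, z') = ∑ x, (slotBlock X x x z z').trace := by
  simp only [trRight, rejectAns, Matrix.of_apply, sum_mem_one, Matrix.trace,
    Matrix.diag_apply, slotBlock]
  rw [Finset.sum_comm]
  refine Finset.sum_congr rfl fun x _ => ?_
  rw [Fintype.sum_prod_type_right]

end OneSlot

/-! ### The attacked state -/

section Attack

theorem ampl_add {α β E : Type} {Φ : SuperOp α β} (hΦ : ∀ X Y, Φ (X + Y) = Φ X + Φ Y)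
    (ρ ρ' : Op (α × E)) : ampl Φ (ρ + ρ') = ampl Φ ρ + ampl Φ ρ' := by
  ext ⟨b, e⟩ ⟨b', e'⟩
  exact congrFun (congrFun (hΦ (Matrix.of fun a a' => ρ (a, e) (a', e'))
    (Matrix.of fun a a' => ρ' (a, e) (a', e'))) b) b'

theorem ampl_smul {α β E R : Type} [SMul R ℂ] {Φ : SuperOp α β} (k : R)
    (hΦ : ∀ X, Φ (k • X) = k • Φ X) (ρ : Op (α × E)) : ampl Φ (k • ρ) = k • ampl Φ ρ := by
  ext ⟨b, e⟩ ⟨b', e'⟩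
  exact congrFun (congrFun (hΦ (Matrix.of fun a a' => ρ (a, e) (a', e'))) b) b'

variable {m t c b b' : ℕ} (F : EncForm m t c) (r : Bits t)

theorem EncForm.encR_add (X Y : Op (Bits m)) : F.encR r (X + Y) = F.encR r X + F.encR r Y := by
  simp only [EncForm.encR, Matrix.add_kronecker, Matrix.mul_add, Matrix.add_mul]

theorem EncForm.unV_add (X Y : Op (Bits c)) : F.unV (X + Y) = F.unV X + F.unV Y := by
  simp only [EncForm.unV, Matrix.mul_add, Matrix.add_mul]

variable (Λ : Op (Bits c × Bits b) →ₗ[ℂ] Op (Bits c × Bits b'))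

/-- Additivity in the `B` part lets the sum over the discarded plaintext be moved into the argument
of `simRej`; this is where linearity of the attack enters. -/
theorem EncForm.attacked_add (Z Z' : Op (Bits b)) :
    F.attacked (fun X => Λ X) r (Z + Z') =
      F.attacked (fun X => Λ X) r Z + F.attacked (fun X => Λ X) r Z' := by
  have h : (Matrix.of fun u v : Bits m × (Bits b × Bits m) =>
      phiPlus m (u.1, u.2.2) (v.1, v.2.2) * (Z + Z') u.2.1 v.2.1) =
      (Matrix.of fun u v => phiPlus m (u.1, u.2.2) (v.1, v.2.2) * Z u.2.1 v.2.1) +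
      (Matrix.of fun u v => phiPlus m (u.1, u.2.2) (v.1, v.2.2) * Z' u.2.1 v.2.1) := by
    ext u v
    exact mul_add _ _ _
  simp only [EncForm.attacked]
  rw [h, ampl_add (F.encR_add r), Matrix.submatrix_add, Pi.add_apply, Pi.add_apply,
    ampl_add (fun X Y => map_add Λ X Y), Matrix.submatrix_add, Pi.add_apply, Pi.add_apply,
    ampl_add F.unV_add, Matrix.submatrix_add, Pi.add_apply, Pi.add_apply]

theorem EncForm.attacked_sum {ι : Type} (S : Finset ι) (Z : ι → Op (Bits b)) :
    F.attacked (fun X => Λ X) r (∑ i ∈ S, Z i) =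
      ∑ i ∈ S, F.attacked (fun X => Λ X) r (Z i) :=
  map_sum (AddMonoidHom.mk' _ (F.attacked_add r Λ)) Z S

theorem EncForm.simAcc_apply (Λ : SuperOp (Bits c × Bits b) (Bits c × Bits b')) (Z : Op (Bits b))
    (z z' : Bits b') :
    F.simAcc Λ r Z z z' =
      (F.phiProj r * Matrix.of fun u v => F.attacked Λ r Z (u, z) (v, z')).trace := by
  simp only [EncForm.simAcc, Matrix.of_apply, Matrix.trace, Matrix.diag_apply, Matrix.mul_apply,
    EncForm.phiProj, Matrix.vecMulVec_apply, Pi.star_apply]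
  rw [Finset.sum_comm]
  refine Finset.sum_congr rfl fun v _ => Finset.sum_congr rfl fun u _ => ?_
  ring

theorem EncForm.simRej_apply (Λ : SuperOp (Bits c × Bits b) (Bits c × Bits b')) (Z : Op (Bits b))
    (z z' : Bits b') :
    F.simRej Λ r Z z z' =
      ((1 - F.phiProj r) * Matrix.of fun u v => F.attacked Λ r Z (u, z) (v, z')).trace := by
  simp only [EncForm.simRej, trLeft, Matrix.of_apply, Matrix.trace, Matrix.diag_apply,
    Matrix.mul_apply, Fintype.sum_prod_type, Matrix.kroneckerMap_apply, Matrix.one_apply,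
    EncForm.phiProj]
  simp

theorem EncForm.simRej_sum {ι : Type} (S : Finset ι) (Z : ι → Op (Bits b)) (z z' : Bits b') :
    F.simRej (fun X => Λ X) r (∑ i ∈ S, Z i) z z' =
      ∑ i ∈ S, F.simRej (fun X => Λ X) r (Z i) z z' := by
  simp only [EncForm.simRej, F.attacked_sum, Finset.mul_sum, trLeft, Matrix.of_apply,
    Matrix.sum_apply]
  exact Finset.sum_comm

/-- The ideal round trip for fixed key and randomness. -/
theorem EncForm.roundTrip_eq (ρ : Op (Bits m × Bits b)) :
    (((F.idealDec [(Fin.last 0, r)] (ampl (fun X => Λ X)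
      (F.idealEnc (l := 0) r (Matrix.of fun u v => ρ u.1 v.1)))).map fun o => trRight o.2).sum :
        Op (Option (Bits m) × Bits b')) =
      acceptOrReject (F.simAcc (fun X => Λ X) r) (F.simRej (fun X => Λ X) r) ρ := by
  set τ := ampl (ampl F.unV) (ampl (fun X => Λ X)
      (F.idealEnc (l := 0) r (Matrix.of fun u v => ρ u.1 v.1))) with hτ
  -- The stored `M` is untouched by the encryption of `M'`, the attack and `V†`, so its basis states
  -- are mere parameters that select a block of `ρ` on `B`. Both sides unfold to the same
  -- expression.
  have hblock : ∀ x y z z', slotBlock τ x y z z' = Matrix.of fun u v =>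
      F.attacked (fun X => Λ X) r (Matrix.of fun z z' => ρ (x, z) (y, z')) (u, z) (v, z') :=
    fun _ _ _ _ => rfl
  have hone : (1 : Op (((Bits m × Bits t) × Bits b') × Mem m (0 + 1))) = onSlot 1 := onSlot_one.symm
  simp only [EncForm.idealDec, EncForm.decLoop, ← hτ, List.map_cons, List.map_nil, List.sum_cons,
    List.sum_nil, add_zero, F.projTag_eq_onSlot, projPlus_eq_onSlot, hone, ← onSlot_sub]
  ext ⟨_ | x, z⟩ ⟨_ | y, z'⟩
  -- Both rejected: summing the blocks over `x` turns the argument into the partial trace of `ρ`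
  -- over `M`. The mixed cases that follow vanish on both sides, since the answer carries no
  -- coherence between acceptance and rejection.
  · rw [Matrix.add_apply, trRight_rejectAns_none]
    simp only [slotBlock_add, slotBlock_mul_onSlot, slotBlock_onSlot_mul, F.trace_reject, hblock,
      ← F.simRej_apply, ← F.simRej_sum]
    simp only [trRight, handOver, acceptOrReject, Matrix.of_apply, Finset.sum_const_zero, zero_add]
    congr 2
    ext
    simp [trLeft, Matrix.sum_apply]
  · simp [trRight, handOver, rejectAns, acceptOrReject]
  · simp [trRight, handOver, rejectAns, acceptOrReject]
  · rw [Matrix.add_apply, trRight_handOver_some]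
    simp only [slotBlock_mul_onSlot, slotBlock_onSlot_mul, F.trace_accept, hblock,
      ← F.simAcc_apply]
    simp [trRight, rejectAns, acceptOrReject]

end Attack

/-! ### Averages over the key -/

namespace SKQES

variable (𝒮 : SKQES)

theorem map_keyAvg {A B : Type} [AddCommMonoid A] [Module ℝ A] [AddCommMonoid B] [Module ℝ B]
    (L : A →ₗ[ℝ] B) (n : ℕ) (f : Bits (𝒮.κ n) → A) :
    L (𝒮.keyAvg n f) = 𝒮.keyAvg n fun k => L (f k) := by
  simp [keyAvg]

theorem keyAvg_congr {A : Type} [AddCommMonoid A] [Module ℝ A] {n : ℕ} {f g : Bits (𝒮.κ n) → A}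
    (h : ∀ k, f k = g k) : 𝒮.keyAvg n f = 𝒮.keyAvg n g := by rw [funext h]

theorem keyAvg_apply {α : Type} (n : ℕ) (f : Bits (𝒮.κ n) → Op α) (i j : α) :
    𝒮.keyAvg n f i j = 𝒮.keyAvg n fun k => f k i j := by
  simp [keyAvg, Matrix.sum_apply]

theorem keyAvg_zero {A : Type} [AddCommMonoid A] [Module ℝ A] (n : ℕ) :
    𝒮.keyAvg n (fun _ => (0 : A)) = 0 := by
  simp [keyAvg]

/-- In the ideal experiment, an attack between an encryption and a decryption query acts as the
simulator. -/
theorem idealRoundTrip_eq_simulator (D : Characterization 𝒮) (n b b' : ℕ)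
    (Λ : Op (Bits (𝒮.c n) × Bits b) →ₗ[ℂ] Op (Bits (𝒮.c n) × Bits b')) :
    𝒮.idealRoundTrip D n (fun X => Λ X) = 𝒮.simulator D n (fun X => Λ X) := by
  funext ρ
  simp only [idealRoundTrip, EncForm.roundTrip_eq]
  ext ⟨_ | x, z⟩ ⟨_ | y, z'⟩ <;>
    simp [keyAvg_apply, Matrix.sum_apply, simulator, acceptOrReject, keyAvg_zero]

end SKQES

/-! ### The experiments for an adversary that makes one encryption and one decryption query -/

theorem toQubits_add {m : ℕ} (X Y : Op (Option (Bits m))) :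
    toQubits (X + Y) = toQubits X + toQubits Y := by
  simp only [toQubits, Matrix.mul_add, Matrix.add_mul]

theorem toQubits_smul {m : ℕ} (a : ℝ) (X : Op (Option (Bits m))) :
    toQubits (a • X) = a • toQubits X := by
  simp only [toQubits, Matrix.mul_smul, Matrix.smul_mul]

theorem toQubits_sum {m : ℕ} {ι : Type} (S : Finset ι) (X : ι → Op (Option (Bits m))) :
    toQubits (∑ i ∈ S, X i) = ∑ i ∈ S, toQubits (X i) :=
  map_sum (AddMonoidHom.mk' _ toQubits_add) X S

namespace Circ

variable {i o p s p' s' : ℕ}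

theorem run_add (C : Circ i o) (X Y : Op (Bits i)) : C.run (X + Y) = C.run X + C.run Y := by
  simp only [run, Matrix.mul_add, Matrix.add_mul, Finset.sum_add_distrib]

theorem run_smul {R : Type} [Monoid R] [DistribMulAction R ℂ] [SMulCommClass R ℂ ℂ]
    [IsScalarTower R ℂ ℂ] (C : Circ i o) (a : R) (X : Op (Bits i)) :
    C.run (a • X) = a • C.run X := by
  simp only [run, Matrix.mul_smul, Matrix.smul_mul, Finset.smul_sum]

theorem run₂_add (C : Circ (p + s) (p' + s')) (X Y : Op (Bits p × Bits s)) :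
    C.run₂ (X + Y) = C.run₂ X + C.run₂ Y := by
  have h := congrArg (split p' s') (C.run_add (join p s X) (join p s Y))
  exact h

theorem run₂_smul (C : Circ (p + s) (p' + s')) (a : ℂ) (X : Op (Bits p × Bits s)) :
    C.run₂ (a • X) = a • C.run₂ X := by
  have h := congrArg (split p' s') (C.run_smul a (join p s X))
  exact h

/-- The channel of a circuit as a linear map. -/
def runLin (C : Circ (p + s) (p' + s')) : Op (Bits p × Bits s) →ₗ[ℂ] Op (Bits p' × Bits s') where
  toFun := C.run₂
  map_add' := C.run₂_add
  map_smul' := C.run₂_smul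

/-- The probability that a distinguisher outputs `1`, given a decrypted plaintext and a side
register. -/
def acceptProb {m b : ℕ} (C : Circ (m + 1 + b) 1) :
    Op (Option (Bits m) × Bits b) →ₗ[ℝ] ℝ where
  toFun ρ := C.probOne (ampl toQubits ρ)
  map_add' ρ ρ' := by
    rw [ampl_add toQubits_add]
    have h := C.run_add (join _ _ (ampl toQubits ρ)) (join _ _ (ampl toQubits ρ'))
    exact congrArg (fun Z : Op (Bits 1) => (Z (fun _ => true) (fun _ => true)).re) h
  map_smul' a ρ := by
    rw [ampl_smul a (toQubits_smul a)]
    have h := C.run_smul a (join _ _ (ampl toQubits ρ))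
    refine (congrArg (fun Z : Op (Bits 1) => (Z (fun _ => true) (fun _ => true)).re) h).trans ?_
    simp [probOne]

theorem run₂_one (C : Circ 0 (p + s)) :
    Circ.run₂ (p := 0) (s := 0) C 1 = split p s C.prepare := by
  have h : join 0 0 1 = 1 := Matrix.submatrix_one_equiv _
  unfold run₂
  rw [h]
  rfl

end Circ

/-- Encoding the answer into qubits does not touch the memory, so it commutes with discarding it.
`Adv.ideal` discards at the very end, `idealRoundTrip` before the encoding. -/
theorem trRight_ampl_ampl_toQubits {m b : ℕ} {E : Type} [Fintype E]
    (X : Op ((Option (Bits m) × Bits b) × E)) :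
    trRight (ampl (ampl toQubits) X) = ampl toQubits (trRight X) := by
  ext ⟨y, z⟩ ⟨y', z'⟩
  have h := toQubits_sum Finset.univ
    fun e => Matrix.of fun a a' => X ((a, z), e) ((a', z'), e)
  have h' := congrFun (congrFun h y) y'
  rw [Matrix.sum_apply] at h'
  refine h'.symm.trans ?_
  simp only [ampl, Matrix.of_apply]
  congr 1
  ext a a'
  simp [trRight, Matrix.sum_apply]

/-! ### The attacker with one encryption and one decryption query -/

namespace SKQES

variable (𝒮 : SKQES) {n b b' : ℕ}

/-- The adversary that prepares `M B`, encrypts `M`, attacks the ciphertext, decrypts, and lets a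
distinguisher decide. -/
def attacker (A₁ : Circ 0 (𝒮.m n + b)) (Λ : Circ (𝒮.c n + b) (𝒮.c n + b'))
    (A₃ : Circ (𝒮.m n + 1 + b') 1) : Adv (𝒮.m n) (𝒮.c n) 0 0 :=
  .enc b A₁ (.dec b' Λ (.done A₃))

variable (A₁ : Circ 0 (𝒮.m n + b)) (Λ : Circ (𝒮.c n + b) (𝒮.c n + b'))
  (A₃ : Circ (𝒮.m n + 1 + b') 1)

theorem encode_attacker : (𝒮.attacker A₁ Λ A₃).encode =
    Tok.enc :: (A₁.encode ++ (Tok.dec :: (Λ.encode ++ (Tok.fin :: A₃.encode)))) := rfl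

/-- The acceptance probability is linear in the state, so averaging probabilities over keys equals
evaluating the averaged state. -/
theorem qaeReal_attacker : 𝒮.qaeReal n (𝒮.attacker A₁ Λ A₃) =
    A₃.probOne (ampl toQubits (𝒮.effective n Λ.run₂ (split _ _ A₁.prepare))) := by
  refine Eq.trans ?_ (𝒮.map_keyAvg A₃.acceptProb n _).symm
  refine 𝒮.keyAvg_congr fun k => ?_
  rw [← Circ.run₂_one]
  rfl

/-- Memory without slots is one-dimensional, so the initial state `1` involves only the empty input
of the circuit. -/
theorem ampl_run₂_one (m : ℕ) {p s : ℕ} (C : Circ 0 (p + s)) :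
    ampl (E := Mem m 0) (Circ.run₂ (p := 0) (s := 0) C) 1 =
      Matrix.of fun u v => split p s C.prepare u.1 v.1 := by
  rw [← Circ.run₂_one]
  ext ⟨u, e⟩ ⟨v, e'⟩
  have : (Matrix.of fun a a' => (1 : Op ((Bits 0 × Bits 0) × Mem m 0)) (a, e) (a', e')) = 1 := by
    ext a a'
    simp [Matrix.one_apply, Subsingleton.elim e e']
  simp only [ampl, Matrix.of_apply, this]

theorem ideal_dec_done {m t c p s b l : ℕ} (F : EncForm m t c) (C : Circ (p + s) (c + b))
    (C' : Circ (m + 1 + b) 1) (entries : List (Fin l × Bits t))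
    (ρ : Op ((Bits p × Bits s) × Mem m l)) :
    (Adv.dec b C (.done C')).ideal F entries ρ =
      C'.acceptProb ((F.idealDec entries (ampl C.run₂ ρ)).map fun o => trRight o.2).sum := by
  rw [map_list_sum, List.map_map, Adv.ideal]
  refine congrArg List.sum (List.map_congr_left fun o _ => ?_)
  rw [Adv.ideal, trRight_ampl_ampl_toQubits]
  rfl

theorem ideal_attacker (D : Characterization 𝒮) (k : Bits (𝒮.κ n)) :
    (𝒮.attacker A₁ Λ A₃).ideal (D.form n k) (l := 0) [] 1 =
      A₃.acceptProb (∑ r, (D.form n k).prob r •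
        (((D.form n k).idealDec [(Fin.last 0, r)] (ampl Λ.run₂ ((D.form n k).idealEnc (l := 0) r
          (Matrix.of fun u v => split _ _ A₁.prepare u.1 v.1)))).map fun o => trRight o.2).sum) := by
  rw [map_sum, ← ampl_run₂_one, attacker, Adv.ideal]
  refine Finset.sum_congr rfl fun r _ => ?_
  rw [map_smul, smul_eq_mul, ideal_dec_done]
  rfl

theorem qaeIdeal_attacker (D : Characterization 𝒮) :
    𝒮.qaeIdeal D n (𝒮.attacker A₁ Λ A₃) =
      A₃.probOne (ampl toQubits (𝒮.simulator D n Λ.run₂ (split _ _ A₁.prepare))) := by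
  -- The circuit's channel enters as the linear map `runLin`, which is what the exact identity
  -- requires.
  have h := 𝒮.idealRoundTrip_eq_simulator D n b b' Λ.runLin
  change 𝒮.idealRoundTrip D n Λ.run₂ = 𝒮.simulator D n Λ.run₂ at h
  rw [← h]
  refine Eq.trans ?_ (𝒮.map_keyAvg A₃.acceptProb n _).symm
  exact 𝒮.keyAvg_congr fun k => 𝒮.ideal_attacker A₁ Λ A₃ D k

/-- QAE security implies computational ciphertext authentication. -/
theorem IsQAE.isCQCA {𝒮 : SKQES} {D : Characterization 𝒮} (h : 𝒮.IsQAE D) : 𝒮.IsCQCA D := by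
  intro b b' Λ hΛ A₁ h₁ A₃ h₃
  have hA : PolyTime fun n => (𝒮.attacker (A₁ n) (Λ n) (A₃ n)).encode := by
    simp only [encode_attacker]
    -- The order of operations mirrors `encode_attacker` from the inside out.
    exact (h₁.append ((hΛ.append (h₃.cons _)).cons _)).cons _
  simpa only [qaeReal_attacker, qaeIdeal_attacker] using h _ hA

end SKQES

end QuantumAE

end

theorem mainTheorem5 (𝒮 : QuantumAE.SKQES) (D : QuantumAE.Characterization 𝒮)
    (hQAE : 𝒮.IsQAE D) (hEff : QuantumAE.EfficientCondition 𝒮 D) :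
    𝒮.IsCQCA D ∧
      ∀ (n b b' : ℕ)
        (Λ : QuantumAE.Op (QuantumAE.Bits (𝒮.c n) × QuantumAE.Bits b) →ₗ[ℂ]
          QuantumAE.Op (QuantumAE.Bits (𝒮.c n) × QuantumAE.Bits b')),
        𝒮.idealRoundTrip D n (fun X => Λ X) = 𝒮.simulator D n (fun X => Λ X) :=
  ⟨hQAE.isCQCA, fun n b b' Λ => 𝒮.idealRoundTrip_eq_simulator D n b b' Λ⟩
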